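/- Let $\mathbf k$ be a field and $n\ge 0$. Let $\mathrm{CM}_n$ be the set of contingency matrices of weight $n$: matrices $M=(m_{ij})_{1\le i\le p,\,1\le j\le q}$ (of any size $p\times q$) of non-negative integers with $\sum m_{ij}=n$ such that for each $i$ some $m_{ij}\neq 0$ and for each $j$ some $m_{ij}\ne 0$. The horizontal contraction $\partial'_iM$ ($0\le i\le p-2$) is obtained by adding the slices $m_{i+1,\bullet}$ and $m_{i+2,\bullet}$, the vertical contraction $\partial''_jM$ ($0\le j\le q-2$) by adding $m_{\bullet,j+1}$ and $m_{\bullet,j+2}$. Partially order $\mathrm{CM}_n$ by: $N\le M$ iff $N$ is obtained from $M$ by a finite series of contractions of both kinds. On $\mathrm{Sym}^n(\mathbb C)=S_n\backslash\mathbb C^n$ consider the following four decompositions. * $\mathcal S_{\mathbb C}$: for a partition $\lambda$ of $n$, the stratum of all $\mathbf z$ whose multiplicities form $\lambda$. * $\mathcal S^{\rm cont}$: for $M\in\mathrm{CM}_n$ of size $p\times q$, the cell $X_M^{\rm cont}$ of all $\mathbf z=\{z_1,\dots,z_n\}$ such that the distinct values of the $\mathrm{Re}(z_\nu)$ are $x_1<\dots<x_p$,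 the distinct values of the $\mathrm{Im}(z_\nu)$ are $y_1<\dots<y_q$, and $m_{ij}=\#\{\nu: \mathrm{Re}(z_\nu)=x_i,\ \mathrm{Im}(z_\nu)=y_j\}$. * $\mathcal S^{\rm FNF}$: for an ordered partition $\beta=(\beta_1,\dots,\beta_q)$ of $n$ and ordered partitions $\gamma^{(j)}$ of $\beta_j$, the cell of all $\mathbf z$ such that the $\mathrm{Im}(z_\nu)$ take the distinct values $y_1<\dots<y_q$ with $y_j$ attained $\beta_j$ times, and the real parts of the points on the line $\mathrm{Im}=y_j$, listed increasingly, have multiplicities $\gamma^{(j)}_1,\gamma^{(j)}_2,\dots$ * $i\mathcal S^{\rm FNF}$: the images of the cells of $\mathcal S^{\rm FNF}$ under the automorphism induced by $x+iy\mapsto y+ix$. For such a decomposition $\mathcal S$, let $\mathrm{Sh}(\mathrm{Sym}^n(\mathbb C),\mathcal S)$ be the category of sheaves of $\mathbf k$-vector spaces whose restriction to each stratum of $\mathcal S$ is locally constant. Let $\mathrm{Rep}(\mathrm{CM}_n,\le)$ be the category of representations of the poset: vector spaces $F_M$ and linear maps $\gamma_{N,M}:F_N\to F_M$ for $N\le M$,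 with $\gamma_{M,M}=\mathrm{Id}$ and $\gamma_{L,M}=\gamma_{N,M}\gamma_{L,N}$ for $L\le N\le M$. A contraction $\partial'_i$ (resp. $\partial''_j$) is called anodyne for $M$ if $X^{\rm cont}_{\partial'_iM}$ (resp. $X^{\rm cont}_{\partial''_jM}$) and $X_M^{\rm cont}$ lie in the same stratum of $\mathcal S_{\mathbb C}$. Then: 1. There is an equivalence of categories $E:\mathrm{Sh}(\mathrm{Sym}^n(\mathbb C),\mathcal S^{\rm cont})\simeq\mathrm{Rep}(\mathrm{CM}_n,\le)$, sending $\mathcal F$ to its stalks along the cells and its generalization maps. That is, there are isomorphisms $\varphi_z:E(\mathcal F)_M\to\mathcal F_z$ for $z\in X_M^{\rm cont}$, natural in $\mathcal F$, such that if $N\le M$, $z\in X_N^{\rm cont}$, $v\in E(\mathcal F)_N$ and $s$ is a section of $\mathcal F$ near $z$ with germ $\varphi_z(v)$ at $z$, then $\varphi_w(\gamma_{N,M}(v))$ is the germ of $s$ at $w$ for all $w\in X_M^{\rm cont}$ sufficiently close to $z$. 2. Every $\mathcal S_{\mathbb C}$-constructible sheaf is $\mathcal S^{\rm cont}$-constructible,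 and $E$ restricts to an equivalence between $\mathrm{Sh}(\mathrm{Sym}^n(\mathbb C),\mathcal S_{\mathbb C})$ and the full subcategory of the representations for which $\gamma_{\partial'_iM,M}$ (resp. $\gamma_{\partial''_jM,M}$) is an isomorphism whenever $\partial'_i$ (resp. $\partial''_j$) is anodyne for $M$. In particular, an $\mathcal S^{\rm cont}$-constructible sheaf $\mathcal F$ is $\mathcal S_{\mathbb C}$-constructible if and only if $E(\mathcal F)$ has this property. 3. An $\mathcal S^{\rm cont}$-constructible sheaf on $\mathrm{Sym}^n(\mathbb C)$ is $\mathcal S_{\mathbb C}$-constructible if and only if it is both $\mathcal S^{\rm FNF}$-constructible and $i\mathcal S^{\rm FNF}$-constructible. -/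

import Mathlib

open CategoryTheory TopologicalSpace

universe u

/-! ### Contingency matrices and their contractions -/

/-- A contingency matrix of weight `n` and size `p × q`: a matrix of non-negative integers with sum
`n` in which no row and no column vanishes. The first index `i : Fin p` will number the distinct
real parts (vertical lines, drawn as the columns) and the second index `j : Fin q` the distinct
imaginary parts (horizontal lines, drawn as the rows) of a configuration of `n` points. -/
@[ext]
structure ContMat (n : ℕ) where
  p : ℕ
  q : ℕ
  m : Fin p → Fin q → ℕ
  fst_ne_zero : ∀ i, ∃ j, m i j ≠ 0
  snd_ne_zero : ∀ j, ∃ i, m i j ≠ 0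
  weight : ∑ i, ∑ j, m i j = n

namespace ContMat

variable {n : ℕ}

/-- The transposed contingency matrix. -/
def transpose (M : ContMat n) : ContMat n where
  p := M.q
  q := M.p
  m := fun j i => M.m i j
  fst_ne_zero := M.snd_ne_zero
  snd_ne_zero := M.fst_ne_zero
  weight := by rw [Finset.sum_comm]; exact M.weight

/-- The surjection of `{0, …, p - 1}` onto `{0, …, p - 2}` which identifies `i` and `i + 1` and is
otherwise strictly increasing. -/
def merge {p : ℕ} (i : Fin (p - 1)) (a : Fin p) : Fin (p - 1) :=
  if h : a.val ≤ i.val then ⟨a.val, by omega⟩ else ⟨a.val - 1, by omega⟩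

theorem merge_surjective {p : ℕ} (i : Fin (p - 1)) : Function.Surjective (merge i) := by
  intro b
  by_cases h : b.val ≤ i.val
  · exact ⟨⟨b.val, by omega⟩, by simp [merge, h]⟩
  · refine ⟨⟨b.val + 1, by omega⟩, ?_⟩
    have h' : ¬ b.val + 1 ≤ i.val := by omega
    simp [merge, h']

/-- The horizontal contraction `∂'_i`, `0 ≤ i ≤ p - 2`, from size `p × q` to size `(p - 1) × q`:
the slices `m i` and `m (i + 1)` are added together. -/
def contrH (M : ContMat n) (i : Fin (M.p - 1)) : ContMat n where
  p := M.p - 1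
  q := M.q
  m := fun b j => ∑ a with merge i a = b, M.m a j
  fst_ne_zero := by
    intro b
    obtain ⟨a, ha⟩ := merge_surjective i b
    obtain ⟨j, hj⟩ := M.fst_ne_zero a
    refine ⟨j, fun h => hj ?_⟩
    rw [Finset.sum_eq_zero_iff] at h
    exact h a (by simp [ha])
  snd_ne_zero := by
    intro j
    obtain ⟨a, ha⟩ := M.snd_ne_zero j
    refine ⟨merge i a, fun h => ha ?_⟩
    rw [Finset.sum_eq_zero_iff] at h
    exact h a (by simp)
  weight := by
    rw [Finset.sum_comm]
    have h : ∀ j, ∑ b, ∑ a with merge i a = b, M.m a j = ∑ a, M.m a j := fun j =>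
      Finset.sum_fiberwise _ _ _
    simp only [h]
    rw [Finset.sum_comm]
    exact M.weight

/-- The vertical contraction `∂''_j`, `0 ≤ j ≤ q - 2`, from size `p × q` to size `p × (q - 1)`. -/
def contrV (M : ContMat n) (j : Fin (M.q - 1)) : ContMat n :=
  (M.transpose.contrH j).transpose

/-- `N` is an elementary (horizontal or vertical) contraction of `M`. -/
def IsContraction (M N : ContMat n) : Prop :=
  (∃ i, N = M.contrH i) ∨ (∃ j, N = M.contrV j)

theorem IsContraction.size_lt {M N : ContMat n} (h : IsContraction M N) :
    N.p + N.q < M.p + M.q := by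
  rcases h with ⟨i, rfl⟩ | ⟨j, rfl⟩
  · have := i.isLt
    change M.p - 1 + M.q < M.p + M.q
    omega
  · have := j.isLt
    change M.p + (M.q - 1) < M.p + M.q
    omega

theorem size_lt_or_eq {M N : ContMat n} (h : Relation.ReflTransGen IsContraction M N) :
    N.p + N.q < M.p + M.q ∨ N = M := by
  induction h with
  | refl => exact Or.inr rfl
  | tail _ h ih =>
    have := h.size_lt
    rcases ih with ih | rfl
    · exact Or.inl (by omega)
    · exact Or.inl this

/-- The partial order of the poset of cells: `N ≤ M` if and only if `N` is obtained from `M` by a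
finite series of horizontal and vertical contractions, so that `∂'_i M ≤ M` and `∂''_j M ≤ M`. -/
instance : PartialOrder (ContMat n) where
  le N M := Relation.ReflTransGen IsContraction M N
  le_refl _ := Relation.ReflTransGen.refl
  le_trans _ _ _ h₁ h₂ := h₂.trans h₁
  le_antisymm A B h₁ h₂ := by
    rcases size_lt_or_eq h₁ with h | h
    · rcases size_lt_or_eq h₂ with h' | h'
      · omega
      · exact h'.symm
    · exact h

theorem contrH_le (M : ContMat n) (i : Fin (M.p - 1)) : M.contrH i ≤ M :=
  Relation.ReflTransGen.single (Or.inl ⟨i, rfl⟩)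

theorem contrV_le (M : ContMat n) (j : Fin (M.q - 1)) : M.contrV j ≤ M :=
  Relation.ReflTransGen.single (Or.inr ⟨j, rfl⟩)

end ContMat

/-! ### The symmetric product and its four stratifications -/

/-- The point `{z_1, …, z_n}` of the symmetric product. -/
def symMk {n : ℕ} (z : Fin n → ℂ) : Sym ℂ n :=
  ⟨Finset.univ.val.map z, by simp⟩

/-- `Sym ℂ n` carries the quotient topology of `ℂⁿ → S_n \ ℂⁿ`. -/
noncomputable instance symTopology (n : ℕ) : TopologicalSpace (Sym ℂ n) :=
  TopologicalSpace.coinduced symMk inferInstance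

/-- The symmetric product `Symⁿ(ℂ)`, placed in the universe of the base field of the sheaves. -/
noncomputable abbrev SymSpace (n : ℕ) : TopCat.{u} := TopCat.of (ULift.{u} (Sym ℂ n))

/-- The unordered collection `{z_1, …, z_n}` underlying a point of the symmetric product. -/
def pts {n : ℕ} (z : Sym ℂ n) : Multiset ℂ := z.1

/-- The complex stratum of the unordered partition `l` of `n`: all `z` whose multiplicities form
the partition `l`. -/
def complexStratum (n : ℕ) (l : n.Partition) : Set (Sym ℂ n) :=
  {z | Nat.Partition.ofSym z = l}

/-- The contingency cell of `M`: there are `p` distinct real parts `x_1 < ⋯ < x_p` and `q` distinct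
imaginary parts `y_1 < ⋯ < y_q` of the points of `z`, and exactly `m i j` points of `z` (with
multiplicity) have real part `x_i` and imaginary part `y_j`. -/
def contCell (n : ℕ) (M : ContMat n) : Set (Sym ℂ n) :=
  {z | ∃ (x : Fin M.p → ℝ) (y : Fin M.q → ℝ), StrictMono x ∧ StrictMono y ∧
    Set.range x = {t | ∃ w ∈ pts z, w.re = t} ∧
    Set.range y = {t | ∃ w ∈ pts z, w.im = t} ∧
    ∀ i j, M.m i j = (pts z).countP (fun w => w.re = x i ∧ w.im = y j)}

/-- The cell `K_β` of the real symmetric product attached to an ordered partition `β`: the divisors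
`β_1 · y_1 + ⋯ + β_q · y_q` with `y_1 < ⋯ < y_q`. -/
def realCell {d : ℕ} (β : Composition d) : Set (Multiset ℝ) :=
  {s | ∃ y : Fin β.length → ℝ, StrictMono y ∧ s = ∑ j, β.blocksFun j • ({y j} : Multiset ℝ)}

/-- Labels of Fox–Neuwirth–Fuchs cells: an ordered partition `β = (β_1, …, β_q)` of `n` and an
ordered partition of each `β_j`. -/
abbrev FNFIndex (n : ℕ) : Type :=
  Σ β : Composition n, ∀ j : Fin β.length, Composition (β.blocksFun j)

/-- The Fox–Neuwirth–Fuchs cell: the imaginary parts of the points of `z` are `y_1 < ⋯ < y_q`, with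
`y_j` attained `β_j` times, and the real parts of the points of `z` on the `j`-th horizontal line
`Im = y_j` form an element of the real cell of `γ⁽ʲ⁾`. -/
def fnfCell (n : ℕ) (a : FNFIndex n) : Set (Sym ℂ n) :=
  {z | ∃ y : Fin a.1.length → ℝ, StrictMono y ∧
    (pts z).map Complex.im = ∑ j, a.1.blocksFun j • ({y j} : Multiset ℝ) ∧
    ∀ j, ((pts z).filter (fun w => w.im = y j)).map Complex.re ∈ realCell (a.2 j)}

/-- The involution `x + iy ↦ y + ix` of `ℂ`. -/
def swapReIm (w : ℂ) : ℂ := ⟨w.im, w.re⟩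

/-- The dual Fox–Neuwirth–Fuchs cell: the image of a Fox–Neuwirth–Fuchs cell under the
automorphism of the symmetric product induced by `x + iy ↦ y + ix`. -/
def ifnfCell (n : ℕ) (a : FNFIndex n) : Set (Sym ℂ n) :=
  Sym.map swapReIm '' fnfCell n a

/-! ### Constructible sheaves -/

section Sheaves

variable (k : Type u) [Field k]

/-- A sheaf of `k`-vector spaces is locally constant if every point has an open neighbourhood on
which the sheaf is isomorphic to a constant sheaf. -/
def IsLocConstSheaf {Y : TopCat.{u}} (G : Y.Sheaf (ModuleCat.{u} k)) : Prop :=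
  ∀ y : Y, ∃ U : Opens Y, y ∈ U ∧
    CategoryTheory.Sheaf.IsConstant _
      ((TopCat.Sheaf.pullback (ModuleCat.{u} k) U.inclusion').obj G)

/-- The restriction (inverse image) of a sheaf to a subspace. -/
noncomputable def restrictSheaf {X : TopCat.{u}} (S : Set X) (F : X.Sheaf (ModuleCat.{u} k)) :
    (TopCat.of S).Sheaf (ModuleCat.{u} k) :=
  (TopCat.Sheaf.pullback (ModuleCat.{u} k)
    (TopCat.ofHom ⟨Subtype.val, continuous_subtype_val⟩ : TopCat.of S ⟶ X)).obj F

/-- Sheaves of `k`-vector spaces on the symmetric product that are constructible for a given family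
of strata: the restriction to each stratum is locally constant. -/
def constructible {n : ℕ} {ι : Type} (S : ι → Set (Sym ℂ n)) :
    ObjectProperty ((SymSpace.{u} n).Sheaf (ModuleCat.{u} k)) :=
  fun F => ∀ a, IsLocConstSheaf k (restrictSheaf k (X := SymSpace n) (ULift.down ⁻¹' S a) F)

/-- The category `Sh(Symⁿ(ℂ), S)` of `S`-constructible sheaves. -/
abbrev ConstrSh {n : ℕ} {ι : Type} (S : ι → Set (Sym ℂ n)) :=
  (constructible.{u} k S).FullSubcategory

/-- Representations of the poset of contingency matrices: vector spaces `F_M` and linear maps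
`γ_{N,M} : F_N → F_M` for `N ≤ M`, compatible with identities and compositions. -/
abbrev ContRep (n : ℕ) := ContMat n ⥤ ModuleCat.{u} k

variable {k}

/-- The functor `E` attaches to a constructible sheaf its stalks along the contingency cells
together with its generalization maps. That is, there are isomorphisms `φ_z` from `E(F)_M` to the
stalk of `F` at `z`, for `z` in the cell of `M`, natural in `F`, such that for `N ≤ M`, if `v` in
`E(F)_N` is carried by `φ_z` to the germ at `z` of a section `s`, then `γ_{N,M}(v)` is carried by
`φ_w` to the germ of `s` at `w`, for all points `w` of the cell of `M` close to `z`. For `N = M`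
this says that `w ↦ φ_w(v)` is a section over the cell of `M` of the restriction of `F`. -/
def IsStalkRep {n : ℕ} (E : ConstrSh.{u} k (contCell n) ⥤ ContRep.{u} k n) : Prop :=
  ∃ φ : ∀ (F : ConstrSh.{u} k (contCell n)) (M : ContMat n) (z : SymSpace.{u} n)
      (_ : z.down ∈ contCell n M), (E.obj F).obj M ≅ F.obj.presheaf.stalk z,
    (∀ (F G : ConstrSh.{u} k (contCell n)) (f : F ⟶ G) (M : ContMat n) (z : SymSpace.{u} n)
      (hz : z.down ∈ contCell n M),
      (E.map f).app M ≫ (φ G M z hz).hom =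
        (φ F M z hz).hom ≫ (TopCat.Presheaf.stalkFunctor _ z).map f.hom.hom) ∧
    (∀ (F : ConstrSh.{u} k (contCell n)) (N M : ContMat n) (h : N ≤ M) (z : SymSpace.{u} n)
      (hz : z.down ∈ contCell n N) (U : Opens (SymSpace.{u} n)) (hzU : z ∈ U)
      (s : F.obj.presheaf.obj (Opposite.op U)) (v : (E.obj F).obj N),
      (φ F N z hz).hom v = F.obj.presheaf.germ U z hzU s →
      ∃ (V : Opens (SymSpace.{u} n)) (_ : z ∈ V) (hVU : V ≤ U),
        ∀ (w : SymSpace.{u} n) (hwV : w ∈ V) (hw : w.down ∈ contCell n M),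
          (φ F M w hw).hom ((E.obj F).map (homOfLE h) v) =
            F.obj.presheaf.germ U w (hVU hwV) s)

/-- Two contingency cells lie in the same complex stratum. -/
def SameComplexStratum {n : ℕ} (N M : ContMat n) : Prop :=
  ∃ l : n.Partition, contCell n N ⊆ complexStratum n l ∧ contCell n M ⊆ complexStratum n l

/-- The horizontal contraction `∂'_i` is anodyne for `M`: the cells of `∂'_i M` and of `M` lie in
the same complex stratum. -/
def AnodyneH {n : ℕ} (M : ContMat n) (i : Fin (M.p - 1)) : Prop :=
  SameComplexStratum (M.contrH i) M

/-- The vertical contraction `∂''_j` is anodyne for `M`. -/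
def AnodyneV {n : ℕ} (M : ContMat n) (j : Fin (M.q - 1)) : Prop :=
  SameComplexStratum (M.contrV j) M

variable (k)

/-- Representations whose structure maps along anodyne contractions are isomorphisms. -/
def anodyneInvertible (n : ℕ) : ObjectProperty (ContRep.{u} k n) :=
  fun R => (∀ M i, AnodyneH M i → IsIso (R.map (homOfLE (M.contrH_le i)))) ∧
    (∀ M j, AnodyneV M j → IsIso (R.map (homOfLE (M.contrV_le j))))

end Sheaves

/-! ### Locally constant sheaves in terms of stalks and germs. -/

section LocallyConstant

open Opposite Topology

variable {k : Type u} [Field k] {X Y Z : TopCat.{u}}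

/-! The argument rests on conicality: for a sheaf constructible along the contingency cells, the
stalk at a point of a cell equals the sections over the open star of that cell, the union of the
cells above it. To see this, lift to ordered configurations. `Degen ζ ξ` says that strict
inequalities between real or imaginary parts in `ζ` persist in `ξ`. The set of such `ξ` is open,
star-shaped about `ζ`, and its image is the open star of the cell of `ζ` (`le_contType_iff`). A ray
from `ζ` to `ξ` enters the cell of `ξ` at once and stays there. Over a cell the étale space is a
covering, so a germ at `ζ` extends uniquely along every ray. The extensions are continuous across
cells because the étale space is a local homeomorphism over the base, and they descend to unordered
configurations by `Degen.symPoint_ray_eq`. This is `bijective_germ_of_cone`, which yields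
`conical_of_constructible`.

For conical sheaves, a morphism is the same as a compatible family of maps between sections over
stars. Conversely, a representation of the poset gives a sheaf of functions that propagate by its
structure maps, with the prescribed stalks. This is `isEquivalence_starSections`.

Constructibility along a larger stratum becomes invertibility of restriction maps between the cells
in it: `Conical.locConstOn` gives one direction, and transport along a ray
(`bijective_res_of_locConstOn`) the other. For the complex strata, elementary contractions suffice:
degeneration can only make points collide, so a chain of contractions between two cells of one
complex stratum never leaves it.

Finally, every Fox–Neuwirth–Fuchs cell lies in one complex stratum. An anodyne horizontal
contraction keeps the imaginary parts and causes no collision, hence preserves the order on each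
horizontal line and stays in one such cell. Vertical contractions follow by transposition, with the
dual cells. -/

theorem bijective_comp {A B C : ModuleCat.{u} k} {f : A ⟶ B} {g : B ⟶ C}
    (hf : Function.Bijective f) (hg : Function.Bijective g) : Function.Bijective (f ≫ g) := by
  exact hg.comp hf

theorem bijective_of_comp_left {A B C : ModuleCat.{u} k} {f : A ⟶ B} {g : B ⟶ C}
    (hf : Function.Bijective f) (h : Function.Bijective (f ≫ g)) : Function.Bijective g := by
  exact (Function.Bijective.of_comp_iff (⇑g) hf).1 h

/-- A family of germs which is locally given by sections comes from a section. -/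
theorem exists_section_of_locally_germ (F : X.Sheaf (ModuleCat.{u} k)) (U : Opens X)
    (g : ∀ x ∈ U, F.presheaf.stalk x)
    (hg : ∀ x ∈ U, ∃ (V : Opens X) (_ : x ∈ V) (s : F.presheaf.obj (op V)),
      ∀ (y : X) (hy : y ∈ V) (hU : y ∈ U), F.presheaf.germ V y hy s = g y hU) :
    ∃ s : F.presheaf.obj (op U), ∀ (x : X) (hx : x ∈ U), F.presheaf.germ U x hx s = g x hx := by
  choose V hV s hs using hg
  let W : U → Opens X := fun x => V x.1 x.2 ⊓ U
  let t : ∀ x : U, F.presheaf.obj (op (W x)) := fun x =>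
    F.presheaf.map (homOfLE inf_le_left).op (s x.1 x.2)
  have ht : ∀ (x : U) (y : X) (hy : y ∈ W x), F.presheaf.germ (W x) y hy (t x) = g y hy.2 := by
    intro x y hy
    rw [TopCat.Presheaf.germ_res_apply]
    exact hs _ _ _ _ _
  obtain ⟨r, hr, -⟩ := F.existsUnique_gluing' W U (fun x => homOfLE inf_le_right)
    (fun x hx => by
      rw [Opens.mem_iSup]
      exact ⟨⟨x, hx⟩, hV x hx, hx⟩) t (by
      intro x y
      apply TopCat.Presheaf.section_ext
      intro z hz
      refine (TopCat.Presheaf.germ_res_apply F.presheaf _ z hz _).trans ?_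
      refine Eq.trans ?_ (TopCat.Presheaf.germ_res_apply F.presheaf _ z hz _).symm
      exact (ht x z hz.1).trans (ht y z hz.2).symm)
  refine ⟨r, fun x hx => ?_⟩
  refine Eq.trans ?_ (ht ⟨x, hx⟩ x ⟨hV x hx, hx⟩)
  rw [← hr ⟨x, hx⟩]
  exact (TopCat.Presheaf.germ_res_apply F.presheaf _ x _ r).symm

/-- Every stalk of the inverse image of a sheaf is a stalk of the sheaf, compatibly with germs. -/
theorem exists_pullback_stalk_iso (f : Y ⟶ X) (F : X.Sheaf (ModuleCat.{u} k)) :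
    ∃ b : ∀ y : Y, F.presheaf.stalk (f y) ≅
        ((TopCat.Sheaf.pullback (ModuleCat.{u} k) f).obj F).presheaf.stalk y,
      ∀ (V : Opens X) (s : F.presheaf.obj (op V)), ∃ (W : Opens Y) (hW : ∀ y, f y ∈ V → y ∈ W)
        (t : ((TopCat.Sheaf.pullback (ModuleCat.{u} k) f).obj F).presheaf.obj (op W)),
          ∀ (y : Y) (hy : f y ∈ V),
            ((TopCat.Sheaf.pullback (ModuleCat.{u} k) f).obj F).presheaf.germ W y (hW y hy) t =
              (b y).hom (F.presheaf.germ V (f y) hy s) := by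
  let P := (TopCat.Presheaf.pullback (ModuleCat.{u} k) f).obj F.presheaf
  let i : (TopCat.Sheaf.pullback (ModuleCat.{u} k) f).obj F ≅
      (presheafToSheaf (Opens.grothendieckTopology Y) (ModuleCat.{u} k)).obj P :=
    (TopCat.Sheaf.pullbackIso (ModuleCat.{u} k) f).app F
  -- Sheafification does not change stalks, so the stalk formula for the presheaf inverse image
  -- carries over to the sheaf.
  let j : P ⟶ ((TopCat.Sheaf.pullback (ModuleCat.{u} k) f).obj F).presheaf :=
    CategoryTheory.toSheafify (Opens.grothendieckTopology Y) P ≫ i.inv.hom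
  have hj : ∀ y : Y, IsIso ((TopCat.Presheaf.stalkFunctor (ModuleCat.{u} k) y).map j) := by
    intro y
    have h1 := TopCat.Presheaf.stalkFunctor_map_unit_toSheafify_isIso y (ModuleCat.{u} k) P
    have h2 : IsIso i.inv.hom := ((sheafToPresheaf _ _).mapIso i.symm).isIso_hom
    rw [Functor.map_comp]
    infer_instance
  refine ⟨fun y => TopCat.Presheaf.stalkPullbackIso (ModuleCat.{u} k) f F.presheaf y ≪≫
    @asIso _ _ _ _ _ (hj y), fun V s => ⟨(Opens.map f).obj V, fun _ h => h, ?_⟩⟩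
  refine ⟨j.app _ (((TopCat.Presheaf.pullbackPushforwardAdjunction
    (ModuleCat.{u} k) f).unit.app F.presheaf).app (op V) s), fun y hy => ?_⟩
  have h := TopCat.Presheaf.germ_stalkPullbackHom (ModuleCat.{u} k) f F.presheaf y V hy
  have h' := congrArg (fun m => m s) (congrArg (fun m => m.hom) h)
  refine (TopCat.Presheaf.stalkFunctor_map_germ_apply _ y hy j _).symm.trans ?_
  exact congrArg ((TopCat.Presheaf.stalkFunctor (ModuleCat.{u} k) y).map j) h'.symm

/-- A sheaf is constant along a map `f` if a fixed vector space is identified with all the stalks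
at the points of the image in such a way that its vectors become sections locally. -/
def ConstAlong (f : Y → X) (F : X.Sheaf (ModuleCat.{u} k)) : Prop :=
  ∃ (A : ModuleCat.{u} k) (a : ∀ y : Y, A ⟶ F.presheaf.stalk (f y)),
    (∀ y, Function.Bijective (a y)) ∧
    ∀ (v : A) (y : Y), ∃ (V : Opens X) (_ : f y ∈ V) (s : F.presheaf.obj (op V)),
      ∀ᶠ y' in 𝓝 y, ∀ h : f y' ∈ V, F.presheaf.germ V (f y') h s = a y' v

theorem ConstAlong.of_iso {f : Y → X} {F G : X.Sheaf (ModuleCat.{u} k)} (i : F ≅ G)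
    (h : ConstAlong f F) : ConstAlong f G := by
  obtain ⟨A, a, ha, hs⟩ := h
  have hi : IsIso i.hom.hom := ((sheafToPresheaf _ _).mapIso i).isIso_hom
  refine ⟨A, fun y => a y ≫ (TopCat.Presheaf.stalkFunctor _ (f y)).map i.hom.hom, fun y => ?_,
    fun v y => ?_⟩
  · exact bijective_comp (ha y) (ConcreteCategory.bijective_of_isIso
      ((TopCat.Presheaf.stalkFunctor (ModuleCat.{u} k) (f y)).map i.hom.hom))
  · obtain ⟨V, hV, s, hs⟩ := hs v y
    refine ⟨V, hV, i.hom.hom.app _ s, hs.mono fun y' hy' h => ?_⟩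
    refine (TopCat.Presheaf.stalkFunctor_map_germ_apply _ _ h i.hom.hom _).symm.trans ?_
    exact congrArg ((TopCat.Presheaf.stalkFunctor _ (f y')).map i.hom.hom) (hy' h)

theorem bijective_germ_const (A : ModuleCat.{u} k) (y : Y) :
    Function.Bijective (TopCat.Presheaf.germ (X := Y) ((Functor.const (Opens Y)ᵒᵖ).obj A) ⊤ y
      trivial) := by
  constructor
  · intro v w h
    obtain ⟨W, hW, i, j, e⟩ := TopCat.Presheaf.germ_eq _ y _ _ v w h
    exact e
  · intro t
    obtain ⟨U, hU, s, rfl⟩ := TopCat.Presheaf.exists_germ_eq _ t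
    refine ⟨s, ?_⟩
    exact (TopCat.Presheaf.germ_res_apply (X := Y) ((Functor.const (Opens Y)ᵒᵖ).obj A)
      (homOfLE le_top) y hU s).symm

theorem constAlong_constantSheaf (A : ModuleCat.{u} k) :
    ConstAlong (X := Y) (fun y : Y => y) ((constantSheaf (Opens.grothendieckTopology Y)
      (ModuleCat.{u} k)).obj A) := by
  let P : Y.Presheaf (ModuleCat.{u} k) := (Functor.const (Opens Y)ᵒᵖ).obj A
  let j := CategoryTheory.toSheafify (Opens.grothendieckTopology Y) P
  refine ⟨A, fun y => TopCat.Presheaf.germ P ⊤ y trivial ≫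
    (TopCat.Presheaf.stalkFunctor _ y).map j, fun y => ?_, fun v y => ?_⟩
  · have h1 := TopCat.Presheaf.stalkFunctor_map_unit_toSheafify_isIso y (ModuleCat.{u} k) P
    exact bijective_comp (bijective_germ_const A y) (ConcreteCategory.bijective_of_isIso
      ((TopCat.Presheaf.stalkFunctor (ModuleCat.{u} k) y).map j))
  · exact ⟨⊤, trivial, j.app _ v, Filter.Eventually.of_forall fun y' h =>
      (TopCat.Presheaf.stalkFunctor_map_germ_apply _ _ h j _).symm⟩

theorem constAlong_id_of_isConstant {G : Y.Sheaf (ModuleCat.{u} k)}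
    (h : Sheaf.IsConstant _ G) : ConstAlong (fun y : Y => y) G := by
  obtain ⟨A, ⟨i⟩⟩ := h.mem_essImage
  exact (constAlong_constantSheaf A).of_iso i

/-- The local sections attached to a vector have prescribed germs, hence glue over every open set.
This defines a map from the constant presheaf, and its sheafification is an isomorphism because it
is one on stalks. -/
theorem isConstant_of_constAlong_id {G : Y.Sheaf (ModuleCat.{u} k)}
    (h : ConstAlong (fun y : Y => y) G) : Sheaf.IsConstant _ G := by
  obtain ⟨A, a, ha, hs⟩ := h
  have hsec : ∀ (U : Opens Y) (v : A), ∃ s : G.presheaf.obj (op U),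
      ∀ (x : Y) (hx : x ∈ U), G.presheaf.germ U x hx s = a x v := by
    intro U v
    refine exists_section_of_locally_germ G U (fun x _ => a x v) fun x hx => ?_
    obtain ⟨V, hV, s, hs⟩ := hs v x
    obtain ⟨W, hW, hWo, hxW⟩ := eventually_nhds_iff.1 hs
    refine ⟨V ⊓ ⟨W, hWo⟩, ⟨hV, hxW⟩, G.presheaf.map (homOfLE inf_le_left).op s, ?_⟩
    intro y hy hU
    rw [TopCat.Presheaf.germ_res_apply]
    exact hW y hy.2 hy.1
  choose σ hσ using hsec
  let P : Y.Presheaf (ModuleCat.{u} k) := (Functor.const (Opens Y)ᵒᵖ).obj A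
  let p : P ⟶ G.presheaf :=
    { app := fun U => ModuleCat.ofHom
        { toFun := fun v => σ U.unop v
          map_add' := fun v w => by
            refine TopCat.Presheaf.section_ext G U.unop _ _ fun x hx => ?_
            refine (hσ U.unop (v + w) x hx).trans ?_
            rw [map_add, ← hσ U.unop v x hx, ← hσ U.unop w x hx]
            exact (map_add _ _ _).symm
          map_smul' := fun c v => by
            refine TopCat.Presheaf.section_ext G U.unop _ _ fun x hx => ?_
            refine (hσ U.unop (c • v) x hx).trans ?_
            rw [map_smul, ← hσ U.unop v x hx]
            exact ((G.presheaf.germ U.unop x hx).hom.map_smul _ _).symm }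
      naturality := fun U V i => by
        ext v
        refine TopCat.Presheaf.section_ext G V.unop _ _ fun x hx => ?_
        refine (hσ V.unop v x hx).trans ?_
        refine Eq.trans ?_ (TopCat.Presheaf.germ_res_apply G.presheaf i.unop x hx _).symm
        exact (hσ U.unop v x _).symm }
  let q : (constantSheaf (Opens.grothendieckTopology Y) (ModuleCat.{u} k)).obj A ⟶ G :=
    ⟨CategoryTheory.sheafifyLift (Opens.grothendieckTopology Y) p G.property⟩
  have hq : ∀ x : Y, IsIso ((TopCat.Presheaf.stalkFunctor (ModuleCat.{u} k) x).map q.hom) := by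
    intro x
    have h1 := TopCat.Presheaf.stalkFunctor_map_unit_toSheafify_isIso x (ModuleCat.{u} k) P
    have h2 : (TopCat.Presheaf.stalkFunctor (ModuleCat.{u} k) x).map
        (CategoryTheory.toSheafify (Opens.grothendieckTopology Y) P) ≫
        (TopCat.Presheaf.stalkFunctor (ModuleCat.{u} k) x).map q.hom =
        (TopCat.Presheaf.stalkFunctor (ModuleCat.{u} k) x).map p := by
      rw [← Functor.map_comp]
      exact congrArg _ (CategoryTheory.toSheafify_sheafifyLift _ p G.property)
    have h4 : P.germ ⊤ x trivial ≫ (TopCat.Presheaf.stalkFunctor (ModuleCat.{u} k) x).map p =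
        a x := by
      ext v
      refine (TopCat.Presheaf.stalkFunctor_map_germ_apply (F := P) ⊤ x trivial p v).trans ?_
      exact hσ ⊤ v x trivial
    refine (ConcreteCategory.isIso_iff_bijective _).2 ?_
    refine bijective_of_comp_left (ConcreteCategory.bijective_of_isIso
      ((TopCat.Presheaf.stalkFunctor (ModuleCat.{u} k) x).map
        (CategoryTheory.toSheafify (Opens.grothendieckTopology Y) P))) ?_
    have h3 := bijective_of_comp_left (g := (TopCat.Presheaf.stalkFunctor _ x).map p)
      (bijective_germ_const A x) (by
        have := ha x
        rw [← h4] at this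
        exact this)
    rw [← h2] at h3
    exact h3
  have : IsIso q := TopCat.Presheaf.isIso_of_stalkFunctor_map_iso (X := Y) (F := _) (G := G) q
  exact ⟨⟨A, ⟨asIso q⟩⟩⟩

/-- Constancy along a map sees only stalks and germs, which inverse image preserves. Two successive
restrictions, to a stratum and then to an open subset of it, can therefore be tested on the ambient
space. -/
theorem constAlong_pullback_iff (f : Y ⟶ X) (g : Z → Y) (hg : Continuous g)
    (F : X.Sheaf (ModuleCat.{u} k)) :
    ConstAlong g ((TopCat.Sheaf.pullback (ModuleCat.{u} k) f).obj F) ↔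
      ConstAlong (fun z => f (g z)) F := by
  obtain ⟨b, hb⟩ := exists_pullback_stalk_iso f F
  constructor
  · rintro ⟨A, a, ha, hs⟩
    refine ⟨A, fun z => a z ≫ (b (g z)).inv, fun z => ?_, fun v z => ?_⟩
    · exact bijective_comp (ha z) (ConcreteCategory.bijective_of_isIso (b (g z)).inv)
    · obtain ⟨V, hV, s, hs⟩ := hs v z
      obtain ⟨U, hU, r, hr⟩ := TopCat.Presheaf.exists_germ_eq _ ((b (g z)).inv (a z v))
      obtain ⟨W, hW, t, ht⟩ := hb U r
      have h1 : (b (g z)).hom ((b (g z)).inv (a z v)) = a z v :=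
        congrArg (fun m => m (a z v)) (congrArg (fun m => m.hom) (b (g z)).inv_hom_id)
      have h2 := ht (g z) hU
      rw [hr, h1, ← hs.self_of_nhds hV] at h2
      obtain ⟨N, hN, i, j, e⟩ := TopCat.Presheaf.germ_eq _ _ _ _ _ _ h2
      refine ⟨U, hU, r, ?_⟩
      filter_upwards [hs, hg.continuousAt.eventually (N.isOpen.mem_nhds hN)] with z' hz' hN' h
      have h3 := hz' (j.le hN')
      have h4 := ht (g z') h
      rw [← TopCat.Presheaf.germ_res_apply _ i _ hN', e, TopCat.Presheaf.germ_res_apply, h3] at h4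
      have h5 := congrArg (b (g z')).inv h4
      refine Eq.trans ?_ h5.symm
      exact (congrArg (fun m => m (F.presheaf.germ U (f (g z')) h r))
        (congrArg (fun m => m.hom) (b (g z')).hom_inv_id)).symm
  · rintro ⟨A, a, ha, hs⟩
    refine ⟨A, fun z => a z ≫ (b (g z)).hom, fun z => ?_, fun v z => ?_⟩
    · exact bijective_comp (ha z) (ConcreteCategory.bijective_of_isIso (b (g z)).hom)
    · obtain ⟨V, hV, s, hs⟩ := hs v z
      obtain ⟨W, hW, t, ht⟩ := hb V s
      refine ⟨W, hW _ hV, t, ?_⟩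
      have hc : Continuous fun z => f (g z) := f.hom.continuous.comp hg
      filter_upwards [hs, hc.continuousAt.eventually (V.isOpen.mem_nhds hV)] with z' hz' hV' h
      refine (ht (g z') hV').trans ?_
      exact congrArg (b (g z')).hom (hz' hV')

/-- A sheaf is locally constant along a subset `S`, in terms of its stalks and germs. -/
def LocConstOn (F : X.Sheaf (ModuleCat.{u} k)) (S : Set X) : Prop :=
  ∀ x ∈ S, ∃ U : Opens X, x ∈ U ∧ ∃ (A : ModuleCat.{u} k)
    (a : ∀ w : X, w ∈ U → w ∈ S → (A ⟶ F.presheaf.stalk w)),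
    (∀ w hU hS, Function.Bijective (a w hU hS)) ∧
    ∀ (v : A) (w : X), w ∈ U → w ∈ S → ∃ (V : Opens X) (_ : w ∈ V) (s : F.presheaf.obj (op V)),
      ∀ (w' : X) (h : w' ∈ V) (hU : w' ∈ U) (hS : w' ∈ S), F.presheaf.germ V w' h s = a w' hU hS v

theorem LocConstOn.mono {F : X.Sheaf (ModuleCat.{u} k)} {S T : Set X} (h : LocConstOn F T)
    (hST : S ⊆ T) : LocConstOn F S := by
  intro x hx
  obtain ⟨U, hU, A, a, ha, hs⟩ := h x (hST hx)
  refine ⟨U, hU, A, fun w hw hS => a w hw (hST hS), fun w hw hS => ha w hw (hST hS),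
    fun v w hw hS => ?_⟩
  obtain ⟨V, hV, s, hs⟩ := hs v w hw (hST hS)
  exact ⟨V, hV, s, fun w' h hU hS => hs w' h hU (hST hS)⟩

theorem isLocConstSheaf_restrictSheaf_iff (F : X.Sheaf (ModuleCat.{u} k)) (S : Set X) :
    IsLocConstSheaf k (restrictSheaf k S F) ↔ LocConstOn F S := by
  let f : TopCat.of S ⟶ X := TopCat.ofHom ⟨Subtype.val, continuous_subtype_val⟩
  have key : ∀ U : Opens (TopCat.of S), Sheaf.IsConstant _
      ((TopCat.Sheaf.pullback (ModuleCat.{u} k) U.inclusion').obj (restrictSheaf k S F)) ↔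
      ConstAlong (fun z : (Opens.toTopCat _).obj U => f (U.inclusion' z)) F := by
    intro U
    rw [← constAlong_pullback_iff f _ U.inclusion'.hom.continuous]
    refine Iff.trans ⟨constAlong_id_of_isConstant, isConstant_of_constAlong_id⟩ ?_
    exact constAlong_pullback_iff U.inclusion' (fun z => z) continuous_id (restrictSheaf k S F)
  constructor
  · intro h x hx
    obtain ⟨U, hU, hc⟩ := h ⟨x, hx⟩
    rw [key] at hc
    obtain ⟨A, a, ha, hs⟩ := hc
    obtain ⟨W, hWo, hW⟩ := isOpen_induced_iff.1 U.isOpen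
    have hWU : ∀ w (hw : w ∈ W) (hS : w ∈ S), (⟨w, hS⟩ : S) ∈ U := by
      intro w hw hS
      have : (⟨w, hS⟩ : S) ∈ (Subtype.val ⁻¹' W : Set S) := hw
      rw [hW] at this
      exact this
    refine ⟨⟨W, hWo⟩, ?_, A, fun w hw hS => a ⟨⟨w, hS⟩, hWU w hw hS⟩,
      fun w hw hS => ha ⟨⟨w, hS⟩, hWU w hw hS⟩, fun v w hw hS => ?_⟩
    · have : (⟨x, hx⟩ : S) ∈ (Subtype.val ⁻¹' W : Set S) := by
        rw [hW]
        exact hU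
      exact this
    · obtain ⟨V, hV, s, hs⟩ := hs v ⟨⟨w, hS⟩, hWU w hw hS⟩
      obtain ⟨N, hN, hNo, hwN⟩ := eventually_nhds_iff.1 hs
      obtain ⟨N₁, hN₁o, rfl⟩ := isOpen_induced_iff.1 hNo
      obtain ⟨N₂, hN₂o, rfl⟩ := isOpen_induced_iff.1 hN₁o
      refine ⟨V ⊓ ⟨N₂, hN₂o⟩, ⟨hV, hwN⟩, F.presheaf.map (homOfLE inf_le_left).op s, ?_⟩
      intro w' h hU hS
      rw [TopCat.Presheaf.germ_res_apply]
      exact hN ⟨⟨w', hS⟩, hWU w' hU hS⟩ h.2 h.1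
  · intro h y
    obtain ⟨U, hU, A, a, ha, hs⟩ := h y.1 y.2
    refine ⟨(Opens.map f).obj U, hU, ?_⟩
    rw [key]
    refine ⟨A, fun z => a _ z.2 z.1.2, fun z => ha _ _ _, fun v z => ?_⟩
    obtain ⟨V, hV, s, hs⟩ := hs v _ z.2 z.1.2
    exact ⟨V, hV, s, Filter.Eventually.of_forall fun z' h => hs _ h z'.2 z'.1.2⟩

end LocallyConstant

/-! ### Étale spaces, covering maps and lifting of paths. -/

section EtaleSpace

open Opposite Topology TopCat.Presheaf

variable {k : Type u} [Field k] {X : TopCat.{u}}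

theorem continuousAt_etaleSpace {T : Type*} [TopologicalSpace T] {F : X.Presheaf (ModuleCat.{u} k)}
    {g : T → F.EtaleSpace} {t : T} (hg : ContinuousAt (fun t' => (g t').base) t)
    {V : Opens X} {s : F.obj (op V)}
    (h : ∀ᶠ t' in 𝓝 t, ∃ h : (g t').base ∈ V, (g t').germ = F.germ V _ h s) :
    ContinuousAt g t := by
  rw [ContinuousAt, tendsto_nhds_generateFrom_iff]
  rintro _ ⟨W, r, rfl⟩ ⟨hW, h'⟩
  obtain ⟨hV, h''⟩ := h.self_of_nhds
  obtain ⟨N, hN, i, j, e⟩ := F.germ_eq _ _ _ _ _ (h''.symm.trans h')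
  filter_upwards [hg.eventually (N.isOpen.mem_nhds hN), h] with t' ht' ⟨hV', h3⟩
  refine ⟨j.le ht', h3.trans ?_⟩
  rw [← F.germ_res_apply i _ ht', e, F.germ_res_apply]

theorem continuous_etaleSpace_mk {T : Type*} [TopologicalSpace T] (F : X.Presheaf (ModuleCat.{u} k))
    (V : Opens X) (s : F.obj (op V)) (f : T → X) (hf : Continuous f) (hV : ∀ t, f t ∈ V) :
    Continuous fun t => (⟨f t, F.germ V (f t) (hV t) s⟩ : F.EtaleSpace) :=
  continuous_iff_continuousAt.2 fun _ => continuousAt_etaleSpace hf.continuousAt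
    (Filter.Eventually.of_forall fun t' => ⟨hV t', rfl⟩)

theorem isLocalHomeomorph_base (F : X.Presheaf (ModuleCat.{u} k)) :
    IsLocalHomeomorph (EtaleSpace.base (F := F)) := by
  classical
  refine IsLocalHomeomorph.mk _ fun e => ?_
  obtain ⟨U, hU, s, hs⟩ := F.exists_germ_eq e.germ
  refine ⟨{
    toFun := EtaleSpace.base
    invFun := fun x => if h : x ∈ U then ⟨x, F.germ U x h s⟩ else e
    source := {g | ∃ h, g.germ = F.germ U g.base h s}
    target := U
    map_source' := fun g hg => hg.1
    map_target' := fun x hx => by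
      simp only [show x ∈ U from hx, dite_true]
      exact ⟨hx, rfl⟩
    left_inv' := by
      rintro ⟨x, g⟩ ⟨hx, hg⟩
      simp only [show x ∈ U from hx, dite_true]
      congr 1
      exact hg.symm
    right_inv' := fun x hx => by simp only [show x ∈ U from hx, dite_true]
    open_source := .basic _ ⟨U, s, rfl⟩
    open_target := U.isOpen
    continuousOn_toFun := (EtaleSpace.continuous_base F).continuousOn
    continuousOn_invFun := by
      rw [continuousOn_iff_continuous_domRestrict]
      refine (continuous_etaleSpace_mk F U s (fun x : (U : Set X) => x.1)
        continuous_subtype_val fun x => x.2).congr fun x => ?_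
      simp only [Set.domRestrict_apply, show x.1 ∈ U from x.2, dite_true] }, ⟨hU, hs.symm⟩,
      fun _ _ => rfl⟩

/-- Where the stalks are identified with a fixed vector space, that space with the discrete topology
is the fibre of a trivialization. Continuity in both directions holds because each of its vectors is
locally the germ of a section. -/
theorem LocConstOn.isCoveringMap {F : X.Sheaf (ModuleCat.{u} k)} {S : Set X}
    (h : LocConstOn F S) :
    IsCoveringMap (S.restrictPreimage (EtaleSpace.base (F := F.presheaf))) := by
  intro x
  obtain ⟨U, hU, A, a, ha, hs⟩ := h x.1 x.2
  let E : ∀ (w : X) (hU : w ∈ U) (hS : w ∈ S), A ≃ F.presheaf.stalk w :=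
    fun w hU hS => Equiv.ofBijective _ (ha w hU hS)
  refine IsEvenlyCovered.to_isEvenlyCovered_preimage (I := WithDiscreteTopology A)
    ⟨inferInstance, Subtype.val ⁻¹' (U : Set X), hU, U.isOpen.preimage continuous_subtype_val,
      U.isOpen.preimage ((EtaleSpace.continuous_base F.presheaf).comp continuous_subtype_val),
      { toFun := fun e => (⟨⟨e.1.1.base, e.1.2⟩, e.2⟩,
          .toTopology ⊥ ((E e.1.1.base e.2 e.1.2).symm e.1.1.germ))
        invFun := fun p => ⟨⟨⟨p.1.1.1, E p.1.1.1 p.1.2 p.1.1.2 p.2.ofTopology⟩, p.1.1.2⟩, p.1.2⟩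
        left_inv := fun e => ?_
        right_inv := fun p => ?_
        continuous_toFun := ?_
        continuous_invFun := ?_ }, fun e => ?_⟩
  · apply Subtype.ext
    apply Subtype.ext
    simp
  · simp
  · refine .prodMk (.subtype_mk (.subtype_mk ((EtaleSpace.continuous_base F.presheaf).comp
      (continuous_subtype_val.comp continuous_subtype_val)) _) _) ?_
    rw [continuous_iff_continuousAt]
    intro e
    rw [ContinuousAt, nhds_discrete (WithDiscreteTopology A), Filter.tendsto_pure]
    obtain ⟨V, hV, s, hs⟩ := hs ((E e.1.1.base e.2 e.1.2).symm e.1.1.germ) e.1.1.base e.2 e.1.2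
    have h1 := hs _ hV e.2 e.1.2
    have h2 := (continuous_subtype_val.comp continuous_subtype_val).continuousAt.eventually
      (EtaleSpace.eventually_nhds e.1.1 hV s
        (h1.trans ((E e.1.1.base e.2 e.1.2).apply_symm_apply _)))
    filter_upwards [h2] with e' he'
    obtain ⟨hV', hg⟩ := he'
    congr 1
    rw [Equiv.symm_apply_eq]
    exact hg.trans (hs _ hV' e'.2 e'.1.2)
  · refine .subtype_mk (.subtype_mk ?_ _) _
    rw [continuous_iff_continuousAt]
    rintro ⟨w, v⟩
    obtain ⟨V, hV, s, hs⟩ := hs v.ofTopology w.1.1 w.2 w.1.2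
    rw [continuousAt_prod_of_discrete_right]
    have hc : Continuous fun w' : (Subtype.val ⁻¹' (U : Set X) : Set S) => w'.1.1 :=
      continuous_subtype_val.comp continuous_subtype_val
    refine continuousAt_etaleSpace hc.continuousAt (V := V) (s := s) ?_
    filter_upwards [hc.continuousAt.eventually (V.isOpen.mem_nhds hV)] with w' hw'
    exact ⟨hw', (hs _ hw' w'.2 w'.1.2).symm⟩
  · rfl

open unitInterval

/-- The initial point may lie outside `S`, as for a ray leaving a smaller cell. Agreement at time
`0` spreads to some positive time because the projection is locally injective; from there uniqueness
of lifts in a covering over the connected interval `t > 0` takes over. -/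
theorem LocConstOn.path_unique {F : X.Sheaf (ModuleCat.{u} k)} {S : Set X} (hS : LocConstOn F S)
    {Γ Γ' : I → F.presheaf.EtaleSpace} (hΓ : Continuous Γ) (hΓ' : Continuous Γ')
    (h : ∀ t, (Γ t).base = (Γ' t).base) (hm : ∀ t, 0 < t → (Γ t).base ∈ S) (h0 : Γ 0 = Γ' 0) :
    Γ = Γ' := by
  have ho : IsOpen {t | Γ t = Γ' t} :=
    (isLocalHomeomorph_base F.presheaf).isLocallyInjective.isOpen_eqLocus hΓ hΓ' (funext h)
  have hne : (𝓝[>] (0 : I)).NeBot := nhdsGT_neBot_of_exists_gt ⟨1, one_pos⟩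
  obtain ⟨t₀, ht₀, hpos⟩ : ∃ t₀ : I, Γ t₀ = Γ' t₀ ∧ 0 < t₀ := by
    have h1 : ∀ᶠ t in 𝓝[>] (0 : I), Γ t = Γ' t := nhdsWithin_le_nhds (ho.mem_nhds h0)
    have h2 : ∀ᶠ t in 𝓝[>] (0 : I), 0 < t := self_mem_nhdsWithin
    exact (h1.and h2).exists
  have hpc : PreconnectedSpace (Set.Ioi (0 : I)) :=
    isPreconnected_iff_preconnectedSpace.1 isPreconnected_Ioi
  have h1 := hS.isCoveringMap.eq_of_comp_eq (A := Set.Ioi (0 : I))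
    (g₁ := fun t => ⟨Γ t.1, hm t.1 t.2⟩)
    (g₂ := fun t => ⟨Γ' t.1, show (Γ' t.1).base ∈ S from h t.1 ▸ hm t.1 t.2⟩)
    ((hΓ.comp continuous_subtype_val).subtype_mk _)
    ((hΓ'.comp continuous_subtype_val).subtype_mk _)
    (funext fun t => Subtype.ext (h t.1)) ⟨t₀, hpos⟩ (Subtype.ext ht₀)
  funext t
  rcases eq_or_lt_of_le (show 0 ≤ t from t.2.1) with rfl | ht
  · exact h0
  · exact congrArg Subtype.val (congrFun h1 ⟨t, ht⟩)

theorem LocConstOn.exists_path_lift {F : X.Sheaf (ModuleCat.{u} k)} {S : Set X}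
    (hS : LocConstOn F S) (γ : C(I, X)) (hγ : ∀ t, γ t ∈ S) (e : F.presheaf.EtaleSpace)
    (he : e.base = γ 0) :
    ∃ Γ : C(I, F.presheaf.EtaleSpace), (∀ t, (Γ t).base = γ t) ∧ Γ 0 = e := by
  obtain ⟨Γ, h1, h2⟩ := hS.isCoveringMap.exists_path_lifts
    ⟨fun t => ⟨γ t, hγ t⟩, γ.continuous.subtype_mk _⟩
    ⟨e, show e.base ∈ S from he ▸ hγ 0⟩ (Subtype.ext he.symm)
  refine ⟨⟨fun t => (Γ t).1, continuous_subtype_val.comp Γ.continuous⟩, fun t => ?_, ?_⟩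
  · exact congrArg Subtype.val (congrFun h1 t)
  · exact congrArg Subtype.val h2

/-! ### Extension of germs over a cone. -/

section Cone

variable {V : Type*} [NormedAddCommGroup V] [NormedSpace ℝ V]

/-- The parametrization of the segment from `z` to `w`. -/
def ray (z w : V) (t : ℝ) : V := z + t • (w - z)

@[simp] theorem ray_zero (z w : V) : ray z w 0 = z := by simp [ray]

@[simp] theorem ray_one (z w : V) : ray z w 1 = w := by simp [ray]

@[simp] theorem ray_self (z : V) (t : ℝ) : ray z z t = z := by simp [ray]

theorem continuous_ray (z : V) : Continuous fun p : V × ℝ => ray z p.1 p.2 := by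
  unfold ray
  fun_prop

/-- Near the apex the germ comes from a section `s`; beyond that it is continued along each ray
inside the stratum containing that ray minus its apex. The strata vary with `w`, so continuity comes
from the local homeomorphism property and not from a covering of the whole cone. -/
theorem exists_lift_of_cone {F : X.Sheaf (ModuleCat.{u} k)} {q : V → X} (hq : Continuous q)
    {C : Set V} {z : V} (hz : z ∈ C)
    (hLC : ∀ w ∈ C, ∃ S, LocConstOn F S ∧ ∀ t : ℝ, 0 < t → t ≤ 1 → q (ray z w t) ∈ S)
    (e : F.presheaf.EtaleSpace) (he : e.base = q z) :
    ∃ g : C → F.presheaf.EtaleSpace, Continuous g ∧ (∀ w, (g w).base = q w) ∧ g ⟨z, hz⟩ = e := by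
  obtain ⟨U, hU, s, hs⟩ := F.presheaf.exists_germ_eq e.germ
  obtain ⟨r, hr, hB⟩ := Metric.isOpen_iff.1 (U.isOpen.preimage hq) z
    (show q z ∈ U from he ▸ hU)
  -- The ray to `w` is followed from the parameter `ε w` on. It is positive, so the path stays in
  -- one stratum, depends continuously on `w`, and is small enough that the starting point lies in
  -- the ball of radius `r`, where `s` is defined.
  let ε : C → ℝ := fun w => min 1 (r / (2 * (‖w.1 - z‖ + 1)))
  have hεc : Continuous ε := by
    refine continuous_const.min (continuous_const.div (by fun_prop) fun w => ?_)
    positivity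
  have hε0 : ∀ w, 0 < ε w := fun w => lt_min one_pos (by positivity)
  have hε1 : ∀ w, ε w ≤ 1 := fun w => min_le_left _ _
  have hεr : ∀ w, q (ray z w.1 (ε w)) ∈ U := by
    intro w
    apply hB
    rw [Metric.mem_ball, ray, dist_self_add_left, norm_smul, Real.norm_of_nonneg (hε0 w).le]
    have h1 : ε w ≤ r / (2 * (‖w.1 - z‖ + 1)) := min_le_right _ _
    calc ε w * ‖w.1 - z‖ ≤ r / (2 * (‖w.1 - z‖ + 1)) * ‖w.1 - z‖ := by gcongr
      _ = r * (‖w.1 - z‖ / (2 * (‖w.1 - z‖ + 1))) := by ring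
      _ < r * 1 := by
        gcongr
        rw [div_lt_one (by positivity)]
        linarith [norm_nonneg (w.1 - z)]
      _ = r := mul_one r
  let H : C(I × C, X) := ⟨fun p => q (ray z p.2.1 (ε p.2 + (1 - ε p.2) * p.1.1)),
    hq.comp ((continuous_ray z).comp (f := fun p : I × C =>
      ((p.2 : V), ε p.2 + (1 - ε p.2) * p.1.1)) (by fun_prop))⟩
  have hpos : ∀ (w : C) (t : I), 0 < ε w + (1 - ε w) * t.1 := fun w t =>
    add_pos_of_pos_of_nonneg (hε0 w) (mul_nonneg (sub_nonneg.2 (hε1 w)) t.2.1)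
  have hle : ∀ (w : C) (t : I), ε w + (1 - ε w) * t.1 ≤ 1 := fun w t => by
    nlinarith [t.2.2, hε1 w]
  have h0 : ∀ w, H (0, w) = q (ray z w.1 (ε w)) := fun w => by simp [H]
  have hU0 : ∀ w, H (0, w) ∈ U := fun w => h0 w ▸ hεr w
  have hΓ : ∀ w : C, ∃ Γ : C(I, F.presheaf.EtaleSpace), (∀ t, (Γ t).base = H (t, w)) ∧
      Γ 0 = ⟨H (0, w), F.presheaf.germ U _ (hU0 w) s⟩ := by
    intro w
    obtain ⟨S, hS, hm⟩ := hLC w.1 w.2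
    exact hS.exists_path_lift ⟨fun t => H (t, w), H.continuous.comp (.prodMk_left w)⟩
      (fun t => hm _ (hpos w t) (hle w t)) _ rfl
  choose Γ hΓb hΓ0 using hΓ
  refine ⟨fun w => Γ w 1, ?_, fun w => ?_, ?_⟩
  · rw [continuous_iff_continuousAt]
    intro w
    -- A local homeomorphism lifts the whole family of rays near `w` continuously, extending the
    -- lift over the ray of `w`; uniqueness on each ray identifies this lift with the chosen ones.
    obtain ⟨N, hN, g', hg', hb, hg0, -⟩ := (isLocalHomeomorph_base F.presheaf).exists_lift_nhds
      (f := H) (g := fun p => Γ p.2 p.1) (funext fun p => hΓb p.2 p.1) (by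
        simp only [hΓ0]
        exact continuous_etaleSpace_mk _ _ _ _ (by fun_prop) _) w (Γ w).continuous
    have h1 : ∀ w' ∈ N, g' (1, w') = Γ w' 1 := by
      intro w' hw'
      obtain ⟨S, hS, hm⟩ := hLC w'.1 w'.2
      have h2 := hS.path_unique (Γ := fun t => g' (t, w')) (Γ' := Γ w')
        (hg'.comp_continuous (by fun_prop) fun t => ⟨trivial, hw'⟩) (Γ w').continuous
        (fun t => (congrFun hb (t, w')).trans (hΓb w' t).symm) (fun t _ => by
          have h3 := congrFun hb (t, w')
          simp only [Function.comp_apply] at h3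
          rw [h3]
          exact hm _ (hpos w' t) (hle w' t)) (hg0 w')
      exact congrFun h2 1
    have h2 : ContinuousAt (fun w' => g' (1, w')) w :=
      ((hg'.comp (Continuous.continuousOn (by fun_prop)) fun w' hw' => ⟨trivial, hw'⟩ :
        ContinuousOn (fun w' => g' (1, w')) N)).continuousAt hN
    refine h2.congr ?_
    filter_upwards [hN] with w' hw' using h1 w' hw'
  · rw [hΓb]
    simp [H]
  · obtain ⟨S, hS, hm⟩ := hLC z hz
    have hzS : q z ∈ S := by simpa using hm 1 one_pos le_rfl
    have h1 := hS.path_unique (Γ := fun _ => e) (Γ' := Γ ⟨z, hz⟩) continuous_const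
      (Γ _).continuous (fun t => by rw [hΓb, he]; simp [H]) (fun t _ => he ▸ hzS) (by
        rw [hΓ0]
        obtain ⟨b, v⟩ := e
        obtain rfl : b = q z := he
        have h2 : H (0, ⟨z, hz⟩) = q z := by simp [H]
        have h3 : ∀ (x : X) (h : x ∈ U), x = q z →
            (⟨q z, v⟩ : F.presheaf.EtaleSpace) = ⟨x, F.presheaf.germ U x h s⟩ := by
          rintro x h rfl
          congr 1
          exact hs.symm
        exact h3 _ _ h2)
    exact (congrFun h1 1).symm

/-- Injectivity is uniqueness of continuation along rays. For surjectivity, the lift over the cone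
takes the same value at two points with the same image, since by `hfib` their rays have the same
image; it thus descends to a family of germs, locally given by sections because `q` is open. -/
theorem bijective_germ_of_cone {F : X.Sheaf (ModuleCat.{u} k)} {q : V → X} (hq : Continuous q)
    (hqo : IsOpenMap q) {C : Set V} (hC : IsOpen C) {z : V} (hz : z ∈ C)
    (hstar : ∀ w ∈ C, ∀ t : ℝ, 0 ≤ t → t ≤ 1 → ray z w t ∈ C)
    (hLC : ∀ w ∈ C, ∃ S, LocConstOn F S ∧ ∀ t : ℝ, 0 < t → t ≤ 1 → q (ray z w t) ∈ S)
    (hfib : ∀ w ∈ C, ∀ w' ∈ C, q w = q w' → ∀ t : ℝ, q (ray z w t) = q (ray z w' t))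
    (U : Opens X) (hU : ∀ x, x ∈ U ↔ ∃ w ∈ C, q w = x) (hzU : q z ∈ U) :
    Function.Bijective (F.presheaf.germ U (q z) hzU) := by
  have hCU : ∀ w ∈ C, q w ∈ U := fun w hw => (hU _).2 ⟨w, hw, rfl⟩
  have hrc : ∀ w : V, Continuous fun t : I => ray z w t.1 := fun w =>
    (continuous_ray z).comp (by fun_prop : Continuous fun t : I => (w, t.1))
  constructor
  · intro s s' h
    refine TopCat.Presheaf.section_ext F U s s' fun x hx => ?_
    obtain ⟨w, hw, rfl⟩ := (hU x).1 hx
    obtain ⟨S, hS, hm⟩ := hLC w hw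
    have h1 := hS.path_unique
      (continuous_etaleSpace_mk F.presheaf U s (fun t : I => q (ray z w t.1))
        (hq.comp (hrc w)) fun t => hCU _ (hstar w hw t.1 t.2.1 t.2.2))
      (continuous_etaleSpace_mk F.presheaf U s' (fun t : I => q (ray z w t.1))
        (hq.comp (hrc w)) fun t => hCU _ (hstar w hw t.1 t.2.1 t.2.2))
      (fun t => rfl) (fun t ht => hm t.1 ht t.2.2) (by
        have h2 : ∀ (x : X) (hx : x ∈ U), x = q z →
            (⟨x, F.presheaf.germ U x hx s⟩ : F.presheaf.EtaleSpace) =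
              ⟨x, F.presheaf.germ U x hx s'⟩ := by
          rintro x hx rfl
          congr 1
        exact h2 _ _ (by simp))
    have h2 := congrFun h1 1
    have h3 : ∀ (x : X) (hx : x ∈ U), x = q w →
        (⟨x, F.presheaf.germ U x hx s⟩ : F.presheaf.EtaleSpace) =
          ⟨x, F.presheaf.germ U x hx s'⟩ →
        F.presheaf.germ U (q w) (hCU w hw) s = F.presheaf.germ U (q w) (hCU w hw) s' := by
      rintro x hx rfl h
      injection h
    exact h3 _ _ (by simp) h2
  · intro v
    obtain ⟨g, hg, hgb, hgz⟩ := exists_lift_of_cone hq hz hLC ⟨q z, v⟩ rfl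
    have hwd : ∀ w w' : C, q w.1 = q w'.1 → g w = g w' := by
      intro w w' h
      obtain ⟨S, hS, hm⟩ := hLC w.1 w.2
      have h1 := hS.path_unique
        (Γ := fun t => g ⟨ray z w.1 t.1, hstar w.1 w.2 t.1 t.2.1 t.2.2⟩)
        (Γ' := fun t => g ⟨ray z w'.1 t.1, hstar w'.1 w'.2 t.1 t.2.1 t.2.2⟩)
        (hg.comp ((hrc _).subtype_mk _)) (hg.comp ((hrc _).subtype_mk _))
        (fun t => by rw [hgb, hgb]; exact hfib w.1 w.2 w'.1 w'.2 h t.1)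
        (fun t ht => by rw [hgb]; exact hm t.1 ht t.2.2) (by simp)
      simpa using congrFun h1 1
    have hval : ∀ x ∈ U, ∃ v : F.presheaf.stalk x, ∀ w : C, q w.1 = x → g w = ⟨x, v⟩ := by
      intro x hx
      obtain ⟨w, hw, rfl⟩ := (hU x).1 hx
      have h1 : ∀ (e : F.presheaf.EtaleSpace) (x : X), e.base = x →
          ∃ v : F.presheaf.stalk x, e = ⟨x, v⟩ := by
        rintro ⟨x, v⟩ _ rfl
        exact ⟨v, rfl⟩
      obtain ⟨v, hv⟩ := h1 _ _ (hgb ⟨w, hw⟩)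
      exact ⟨v, fun w' hw' => (hwd w' ⟨w, hw⟩ hw').trans hv⟩
    choose c hc using hval
    obtain ⟨s, hs⟩ := exists_section_of_locally_germ F U c (by
      intro x hx
      obtain ⟨w, hw, rfl⟩ := (hU x).1 hx
      obtain ⟨W, hW, s, hs⟩ := EtaleSpace.exists_section_of_tendsto (hg.tendsto ⟨w, hw⟩)
      obtain ⟨N, hN, hNo, hwN⟩ := eventually_nhds_iff.1 hs
      have hO : IsOpen (q '' (Subtype.val '' N)) := hqo _ (hC.isOpenMap_subtype_val _ hNo)
      have hxW : q w ∈ W := by rw [hgb] at hW; exact hW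
      refine ⟨W ⊓ ⟨_, hO⟩, ⟨hxW, w, ⟨_, hwN, rfl⟩, rfl⟩,
        F.presheaf.map (homOfLE inf_le_left).op s, ?_⟩
      rintro y hy hyU
      rw [F.presheaf.germ_res_apply]
      obtain ⟨hyW, _, ⟨w', hw', rfl⟩, rfl⟩ := hy
      have h1 := hN w' hw'
      rw [hc _ hyU w' rfl] at h1
      obtain ⟨_, h2⟩ := h1
      exact h2.symm)
    refine ⟨s, ?_⟩
    rw [hs]
    have h1 := hc _ hzU ⟨z, hz⟩ rfl
    rw [hgz] at h1
    injection h1 with _ h1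
    exact h1.symm

end Cone

end EtaleSpace

/-! ### Conical sheaves and representations of the poset of cells. -/

section PosetStratification

open Opposite Topology TopCat.Presheaf

variable {k : Type u} [Field k] {X : TopCat.{u}}

/-- A decomposition of a space into nonempty cells indexed by a preorder, such that the union of
the cells above a given one is open. -/
structure PosetStratification (X : TopCat.{u}) (P : Type) [Preorder P] where
  cell : X → P
  isOpen_le : ∀ M, IsOpen {x | M ≤ cell x}
  surjective : Function.Surjective cell

namespace PosetStratification

variable {P : Type} [Preorder P] (c : PosetStratification X P)

/-- The open star of a cell. -/
def star (M : P) : Opens X := ⟨{x | M ≤ c.cell x}, c.isOpen_le M⟩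

theorem mem_star_cell (x : X) : x ∈ c.star (c.cell x) := le_refl (c.cell x)

theorem star_le {N M : P} (h : N ≤ M) : c.star M ≤ c.star N := fun _ hx => h.trans hx

/-- The functor of open stars. -/
def starFunctor : P ⥤ (Opens X)ᵒᵖ where
  obj M := op (c.star M)
  map h := (homOfLE (c.star_le (leOfHom h))).op

variable (k) in
/-- Sections over the open stars of the cells. -/
noncomputable def starSections : X.Sheaf (ModuleCat.{u} k) ⥤ P ⥤ ModuleCat.{u} k :=
  TopCat.Sheaf.forget _ _ ⋙ (Functor.whiskeringLeft P (Opens X)ᵒᵖ (ModuleCat.{u} k)).obj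
    c.starFunctor

/-- A sheaf is conical if its stalks are its sections over the open stars. -/
def Conical (F : X.Sheaf (ModuleCat.{u} k)) : Prop :=
  ∀ x, Function.Bijective (F.presheaf.germ (c.star (c.cell x)) x (c.mem_star_cell x))

/-- Restriction of sections from a larger star to a smaller one. -/
abbrev res (F : X.Sheaf (ModuleCat.{u} k)) {N M : P} (h : N ≤ M) :
    F.presheaf.obj (op (c.star N)) ⟶ F.presheaf.obj (op (c.star M)) :=
  F.presheaf.map (homOfLE (c.star_le h)).op

variable {c}

theorem Conical.bijective_germ {F : X.Sheaf (ModuleCat.{u} k)} (hF : c.Conical F) {M : P} {x : X}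
    (h : c.cell x = M) (hx : x ∈ c.star M) : Function.Bijective (F.presheaf.germ (c.star M) x hx) := by
  subst h
  exact hF x

/-- On the star of the cell of `x`, take the sections over that star as the fixed space. Their germ
at `w` is restriction to the star of the cell of `w`, bijective by assumption on `S`, followed by a
germ map that is bijective by conicality. -/
theorem Conical.locConstOn {F : X.Sheaf (ModuleCat.{u} k)} (hF : c.Conical F) {S : Set X}
    (hS : ∀ x ∈ S, ∀ y ∈ S, ∀ h : c.cell x ≤ c.cell y, Function.Bijective (c.res F h)) :
    LocConstOn F S := by
  intro x hx
  refine ⟨c.star (c.cell x), c.mem_star_cell x, F.presheaf.obj (op (c.star (c.cell x))),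
    fun w hw _ => F.presheaf.germ _ w hw, fun w hw hwS => ?_,
    fun v w hw _ => ⟨_, hw, v, fun _ _ _ _ => rfl⟩⟩
  have h := bijective_comp (hS x hx w hwS hw) (hF w)
  rwa [F.presheaf.germ_res] at h

-- Germs along the path can be transported both ways. Backward transport from `γ 1` to `γ 0` gives
-- injectivity; for surjectivity, the transported germ at `γ 0` comes from a section over the larger
-- star, whose germs follow the same lift forward.
open unitInterval in
theorem Conical.bijective_res {F : X.Sheaf (ModuleCat.{u} k)} (hF : c.Conical F) {S : Set X}
    (hS : LocConstOn F S) {N M : P} (h : N ≤ M) (γ : C(I, X)) (hγ : ∀ t, γ t ∈ S)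
    (h0 : c.cell (γ 0) = N) (h1 : c.cell (γ 1) = M) (hN : ∀ t, γ t ∈ c.star N) :
    Function.Bijective (c.res F h) := by
  have hM : γ 1 ∈ c.star M := h1.ge
  have hg : ∀ s : F.presheaf.obj (op (c.star N)), F.presheaf.germ (c.star M) (γ 1) hM (c.res F h s) =
      F.presheaf.germ (c.star N) (γ 1) (hN 1) s := fun s =>
    F.presheaf.germ_res_apply _ _ _ _
  let L : F.presheaf.obj (op (c.star N)) → C(I, F.presheaf.EtaleSpace) := fun s =>
    ⟨fun t => ⟨γ t, F.presheaf.germ _ (γ t) (hN t) s⟩,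
      continuous_etaleSpace_mk _ _ _ _ γ.continuous _⟩
  constructor
  · intro s s' e
    have e1 : L s 1 = L s' 1 := by
      change EtaleSpace.mk _ _ = EtaleSpace.mk _ _
      rw [← hg s, ← hg s', e]
    have e2 := hS.path_unique (Γ := fun t => L s (unitInterval.symm t))
      (Γ' := fun t => L s' (unitInterval.symm t))
      ((L s).continuous.comp unitInterval.continuous_symm)
      ((L s').continuous.comp unitInterval.continuous_symm) (fun _ => rfl) (fun _ _ => hγ _)
      (by simpa using e1)
    have e3 : L s 0 = L s' 0 := by simpa using congrFun e2 1
    injection e3 with _ e3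
    exact (hF.bijective_germ h0 (hN 0)).1 e3
  · intro τ
    obtain ⟨Γ, hΓ, hΓ0⟩ := hS.exists_path_lift ⟨fun t => γ (unitInterval.symm t), by fun_prop⟩
      (fun t => hγ _) ⟨γ 1, F.presheaf.germ _ (γ 1) hM τ⟩ (by simp)
    have e0 : ∀ (e : F.presheaf.EtaleSpace) (x : X), e.base = x →
        ∃ v : F.presheaf.stalk x, e = ⟨x, v⟩ := by
      rintro ⟨x, v⟩ _ rfl
      exact ⟨v, rfl⟩
    obtain ⟨v, hv⟩ := e0 (Γ 1) (γ 0) (by rw [hΓ]; simp)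
    obtain ⟨s, rfl⟩ := (hF.bijective_germ h0 (hN 0)).2 v
    have e1 := hS.path_unique (Γ := L s) (Γ' := fun t => Γ (unitInterval.symm t))
      (L s).continuous (Γ.continuous.comp unitInterval.continuous_symm)
      (fun t => by rw [hΓ]; simp [L]) (fun t _ => hγ t) (by simpa [L] using hv.symm)
    refine ⟨s, (hF.bijective_germ h1 hM).1 ?_⟩
    rw [hg]
    have e2 : L s 1 = ⟨γ 1, F.presheaf.germ _ (γ 1) hM τ⟩ := by
      rw [congrFun e1 1, ← hΓ0]
      simp
    injection e2

theorem exists_hom_of_stalk_maps {F G : X.Sheaf (ModuleCat.{u} k)}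
    (θ : ∀ x, F.presheaf.stalk x ⟶ G.presheaf.stalk x)
    (h : ∀ (U : Opens X) (s : F.presheaf.obj (op U)), ∀ x ∈ U, ∃ (V : Opens X) (_ : x ∈ V)
      (t : G.presheaf.obj (op V)), ∀ (y : X) (hV : y ∈ V) (hU : y ∈ U),
        G.presheaf.germ V y hV t = θ y (F.presheaf.germ U y hU s)) :
    ∃ f : F ⟶ G, ∀ (U : Opens X) (s : F.presheaf.obj (op U)) (x : X) (hx : x ∈ U),
      G.presheaf.germ U x hx (f.hom.app (op U) s) = θ x (F.presheaf.germ U x hx s) := by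
  choose σ hσ using fun U s => exists_section_of_locally_germ G U
    (fun x hx => θ x (F.presheaf.germ U x hx s)) (h U s)
  let f : F.presheaf ⟶ G.presheaf :=
    { app := fun U => ModuleCat.ofHom
        { toFun := fun v => σ U.unop v
          map_add' := fun v w => by
            refine TopCat.Presheaf.section_ext G U.unop _ _ fun x hx => ?_
            refine (hσ U.unop (v + w) x hx).trans ?_
            rw [map_add, map_add, ← hσ U.unop v x hx, ← hσ U.unop w x hx]
            exact (map_add _ _ _).symm
          map_smul' := fun a v => by
            refine TopCat.Presheaf.section_ext G U.unop _ _ fun x hx => ?_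
            refine (hσ U.unop (a • v) x hx).trans ?_
            refine Eq.trans ?_ ((G.presheaf.germ U.unop x hx).hom.map_smul _ _).symm
            refine (congrArg (θ x) ((F.presheaf.germ U.unop x hx).hom.map_smul _ _)).trans ?_
            refine ((θ x).hom.map_smul _ _).trans ?_
            exact congrArg (a • ·) (hσ U.unop v x hx).symm }
      naturality := fun U V i => by
        ext v
        refine TopCat.Presheaf.section_ext G V.unop _ _ fun x hx => ?_
        refine (hσ V.unop _ x hx).trans ?_
        refine (congrArg (θ x) (TopCat.Presheaf.germ_res_apply F.presheaf i.unop x hx v)).trans ?_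
        refine Eq.trans ?_ (TopCat.Presheaf.germ_res_apply G.presheaf i.unop x hx _).symm
        exact (hσ U.unop v x _).symm }
  exact ⟨⟨f⟩, hσ⟩

theorem Conical.hom_ext {F G : X.Sheaf (ModuleCat.{u} k)} (hF : c.Conical F) {f g : F ⟶ G}
    (h : (c.starSections k).map f = (c.starSections k).map g) : f = g := by
  apply ObjectProperty.hom_ext
  ext U s
  refine TopCat.Presheaf.section_ext G U.unop _ _ fun x hx => ?_
  obtain ⟨σ, hσ⟩ := (hF x).2 (F.presheaf.germ U.unop x hx s)
  have h1 : ∀ f : F ⟶ G, G.presheaf.germ U.unop x hx (f.hom.app U s) =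
      G.presheaf.germ _ x (c.mem_star_cell x) (((c.starSections k).map f).app (c.cell x) σ) := by
    intro f
    refine (TopCat.Presheaf.stalkFunctor_map_germ_apply _ x hx f.hom s).symm.trans ?_
    refine Eq.trans ?_ (TopCat.Presheaf.stalkFunctor_map_germ_apply _ x _ f.hom σ)
    exact congrArg _ hσ.symm
  exact (h1 f).trans ((by rw [h] : _ = _).trans (h1 g).symm)

/-- Conicality turns the maps over stars into stalk maps `θ`. Naturality makes `θ` compatible with
germs of star sections at every point of the star, and every section is locally a star section, so
`θ` comes from a sheaf morphism. -/
theorem Conical.exists_map_eq {F G : X.Sheaf (ModuleCat.{u} k)} (hF : c.Conical F)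
    (η : (c.starSections k).obj F ⟶ (c.starSections k).obj G) :
    ∃ f : F ⟶ G, (c.starSections k).map f = η := by
  have hi : ∀ x, IsIso (F.presheaf.germ (c.star (c.cell x)) x (c.mem_star_cell x)) := fun x =>
    (ConcreteCategory.isIso_iff_bijective _).2 (hF x)
  let ζ : ∀ M, F.presheaf.obj (op (c.star M)) ⟶ G.presheaf.obj (op (c.star M)) := fun M => η.app M
  have hζ : ∀ (N M : P) (h : N ≤ M), c.res F h ≫ ζ M = ζ N ≫ c.res G h := fun N M h =>
    η.naturality (homOfLE h)
  let θ : ∀ x, F.presheaf.stalk x ⟶ G.presheaf.stalk x := fun x =>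
    inv (F.presheaf.germ (c.star (c.cell x)) x (c.mem_star_cell x)) ≫ ζ (c.cell x) ≫
      G.presheaf.germ (c.star (c.cell x)) x (c.mem_star_cell x)
  have hθ : ∀ (M : P) (x : X) (hx : x ∈ c.star M),
      F.presheaf.germ (c.star M) x hx ≫ θ x = ζ M ≫ G.presheaf.germ (c.star M) x hx := by
    intro M x hx
    have h1 : F.presheaf.germ (c.star M) x hx = c.res F hx ≫
      F.presheaf.germ (c.star (c.cell x)) x (c.mem_star_cell x) := (F.presheaf.germ_res _ _ _).symm
    have h2 : G.presheaf.germ (c.star M) x hx = c.res G hx ≫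
      G.presheaf.germ (c.star (c.cell x)) x (c.mem_star_cell x) := (G.presheaf.germ_res _ _ _).symm
    rw [h1, h2, Category.assoc, IsIso.hom_inv_id_assoc]
    exact (Category.assoc _ _ _).symm.trans ((congrArg (· ≫ _) (hζ M _ hx)).trans
      (Category.assoc _ _ _))
  have hθ' : ∀ (M : P) (x : X) (hx : x ∈ c.star M) (s : F.presheaf.obj (op (c.star M))),
      θ x (F.presheaf.germ (c.star M) x hx s) = G.presheaf.germ (c.star M) x hx (ζ M s) :=
    fun M x hx s => congrArg (fun m => m.hom s) (hθ M x hx)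
  obtain ⟨f, hf⟩ := exists_hom_of_stalk_maps θ (fun U s x hx => by
    obtain ⟨σ, hσ⟩ := (hF x).2 (F.presheaf.germ U x hx s)
    obtain ⟨N, hN, i, j, e⟩ := F.presheaf.germ_eq _ _ _ _ _ hσ
    refine ⟨N, hN, G.presheaf.map i.op (ζ (c.cell x) σ), fun y hy hU => ?_⟩
    rw [G.presheaf.germ_res_apply, ← F.presheaf.germ_res_apply j y hy, ← e,
      F.presheaf.germ_res_apply]
    exact (hθ' _ _ _ _).symm)
  refine ⟨f, ?_⟩
  ext M s
  refine TopCat.Presheaf.section_ext G (c.star M) _ _ fun x hx => ?_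
  exact (hf (c.star M) s x hx).trans (hθ' M x hx s)

variable (c)

/-- The functions on open sets with values in a representation of the poset of cells which are
locally propagated by the structure maps. -/
def propagated (R : P ⥤ ModuleCat.{u} k) : TopCat.LocalPredicate fun x : X => R.obj (c.cell x) where
  pred {U} s := ∀ x : U, ∃ V : Opens X, x.1 ∈ V ∧ ∀ y : U, y.1 ∈ V →
    ∃ h : c.cell x ≤ c.cell y, s y = R.map (homOfLE h) (s x)
  res {U V} i s hs x := by
    obtain ⟨W, hW, h⟩ := hs (i x)
    exact ⟨W, hW, fun y hy => h (i y) hy⟩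
  locality {U} s hs x := by
    obtain ⟨V, hV, i, h⟩ := hs x
    obtain ⟨W, hW, h⟩ := h ⟨x, hV⟩
    exact ⟨W ⊓ V, ⟨hW, hV⟩, fun y hy => h ⟨y, hy.2⟩ hy.1⟩

/-- The space of propagated functions on an open set. -/
def propagatedSubmodule (R : P ⥤ ModuleCat.{u} k) (U : Opens X) :
    Submodule k (∀ x : U, R.obj (c.cell x)) where
  carrier := {s | (c.propagated R).pred s}
  zero_mem' x := by
    refine ⟨c.star (c.cell x), c.mem_star_cell _, fun y hy => ⟨hy, ?_⟩⟩
    exact (map_zero (R.map (homOfLE (show c.cell x ≤ c.cell y from hy))).hom).symm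
  add_mem' {s t} hs ht x := by
    obtain ⟨V, hV, h⟩ := hs x
    obtain ⟨W, hW, h'⟩ := ht x
    refine ⟨V ⊓ W, ⟨hV, hW⟩, fun y hy => ?_⟩
    obtain ⟨hl, e⟩ := h y hy.1
    obtain ⟨_, e'⟩ := h' y hy.2
    refine ⟨hl, ?_⟩
    rw [Pi.add_apply, e, e']
    exact (map_add (R.map (homOfLE hl)).hom _ _).symm
  smul_mem' a s hs x := by
    obtain ⟨V, hV, h⟩ := hs x
    refine ⟨V, hV, fun y hy => ?_⟩
    obtain ⟨hl, e⟩ := h y hy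
    refine ⟨hl, ?_⟩
    rw [Pi.smul_apply, e]
    exact ((R.map (homOfLE hl)).hom.map_smul _ _).symm

/-- The presheaf of propagated functions. -/
def propagatedPresheaf (R : P ⥤ ModuleCat.{u} k) : X.Presheaf (ModuleCat.{u} k) where
  obj U := ModuleCat.of k (c.propagatedSubmodule R U.unop)
  map {U V} i := ModuleCat.ofHom
    { toFun := fun s => ⟨fun x => s.1 (i.unop x), (c.propagated R).res i.unop s.1 s.2⟩
      map_add' := fun _ _ => rfl
      map_smul' := fun _ _ => rfl }

/-- The sheaf attached to a representation of the poset of cells. -/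
def propagatedSheaf (R : P ⥤ ModuleCat.{u} k) : X.Sheaf (ModuleCat.{u} k) :=
  ⟨c.propagatedPresheaf R, by
    refine (TopCat.Presheaf.isSheaf_iff_isSheaf_comp (forget (ModuleCat.{u} k)) _).2 ?_
    refine TopCat.Presheaf.isSheaf_of_iso ?_ (TopCat.subpresheafToTypes.isSheaf (c.propagated R))
    exact NatIso.ofComponents (fun U => Iso.refl _) fun _ => rfl⟩

/-- The propagated function on a star with given value on the cell. -/
def propagate (R : P ⥤ ModuleCat.{u} k) (M : P) :
    R.obj M ⟶ (c.propagatedSheaf R).presheaf.obj (op (c.star M)) :=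
  ModuleCat.ofHom
    { toFun := fun v => ⟨fun x => R.map (homOfLE (show M ≤ c.cell x from x.2)) v, fun x =>
        ⟨c.star (c.cell x), c.mem_star_cell _, fun y hy => ⟨hy, by
          refine Eq.trans ?_ (congrArg (fun m => m.hom v) (R.map_comp _ _))
          rfl⟩⟩⟩
      map_add' := fun v w => Subtype.ext (funext fun x => map_add (R.map _).hom v w)
      map_smul' := fun a v => Subtype.ext (funext fun x => (R.map _).hom.map_smul a v) }

/-- The value of a propagated function at `x` determines its values nearby, so the stalk at `x` is
the space attached to the cell of `x`. -/
theorem propagatedSheaf_germ_eq_iff (R : P ⥤ ModuleCat.{u} k) {U V : Opens X} {x : X} (hU : x ∈ U)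
    (hV : x ∈ V) (s : (c.propagatedSheaf R).presheaf.obj (op U))
    (t : (c.propagatedSheaf R).presheaf.obj (op V)) :
    (c.propagatedSheaf R).presheaf.germ U x hU s = (c.propagatedSheaf R).presheaf.germ V x hV t ↔
      s.1 ⟨x, hU⟩ = t.1 ⟨x, hV⟩ := by
  constructor
  · intro h
    obtain ⟨N, hN, i, j, e⟩ := TopCat.Presheaf.germ_eq _ _ _ _ _ _ h
    exact congrFun (congrArg Subtype.val e) ⟨x, hN⟩
  · intro h
    obtain ⟨A, hA, h1⟩ := s.2 ⟨x, hU⟩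
    obtain ⟨B, hB, h2⟩ := t.2 ⟨x, hV⟩
    refine TopCat.Presheaf.germ_ext _ ((A ⊓ U) ⊓ (B ⊓ V)) ⟨⟨hA, hU⟩, ⟨hB, hV⟩⟩
      (homOfLE (inf_le_left.trans inf_le_right)) (homOfLE (inf_le_right.trans inf_le_right)) ?_
    refine Subtype.ext (funext fun y => ?_)
    obtain ⟨hl, e⟩ := h1 ⟨y.1, y.2.1.2⟩ y.2.1.1
    obtain ⟨_, e'⟩ := h2 ⟨y.1, y.2.2.2⟩ y.2.2.1
    refine e.trans (Eq.trans ?_ e'.symm)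
    exact congrArg (R.map (homOfLE hl)) h

theorem bijective_propagate_germ (R : P ⥤ ModuleCat.{u} k) {M : P} {x : X} (h : c.cell x = M)
    (hx : x ∈ c.star M) :
    Function.Bijective (c.propagate R M ≫ (c.propagatedSheaf R).presheaf.germ (c.star M) x hx) := by
  subst h
  have hid : ∀ v, (c.propagate R (c.cell x) v).1 ⟨x, hx⟩ = v := fun v =>
    congrArg (fun m => m.hom v) (R.map_id (c.cell x))
  constructor
  · intro v w e
    have e' := (c.propagatedSheaf_germ_eq_iff R hx hx (c.propagate R _ v) (c.propagate R _ w)).1 e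
    rwa [hid, hid] at e'
  · intro t
    obtain ⟨U, hU, s, rfl⟩ := TopCat.Presheaf.exists_germ_eq _ t
    refine ⟨s.1 ⟨x, hU⟩, ?_⟩
    exact (c.propagatedSheaf_germ_eq_iff R hx hU (c.propagate R _ _) s).2 (hid _)

theorem propagatedSheaf_locConstOn_cell (R : P ⥤ ModuleCat.{u} k) (M : P) :
    LocConstOn (c.propagatedSheaf R) (c.cell ⁻¹' {M}) := fun x hx =>
  ⟨c.star M, show M ≤ c.cell x from hx.ge, R.obj M, fun w hw _ => c.propagate R M ≫
    (c.propagatedSheaf R).presheaf.germ (c.star M) w hw,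
    fun _ hw hS => c.bijective_propagate_germ R hS hw,
    fun v _ hw _ => ⟨_, hw, c.propagate R M v, fun _ _ _ _ => rfl⟩⟩

/-- Propagation followed by the germ at a point of the cell is always bijective, and conicality
makes the germ map bijective; hence propagation itself is an isomorphism, natural by functoriality
of `R`. -/
theorem nonempty_starSections_iso (R : P ⥤ ModuleCat.{u} k) (hR : c.Conical (c.propagatedSheaf R)) :
    Nonempty ((c.starSections k).obj (c.propagatedSheaf R) ≅ R) := by
  have hb : ∀ M, IsIso (c.propagate R M) := by
    intro M
    obtain ⟨x, hx⟩ := c.surjective M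
    rw [ConcreteCategory.isIso_iff_bijective]
    have h1 := c.bijective_propagate_germ R hx hx.ge
    have h2 := hR.bijective_germ hx hx.ge
    exact (Function.Bijective.of_comp_iff' h2 (c.propagate R M)).1 h1
  refine ⟨(NatIso.ofComponents (fun M => @asIso _ _ _ _ (c.propagate R M) (hb M)) ?_).symm⟩
  intro N M f
  ext v
  refine Subtype.ext (funext fun y => ?_)
  exact (congrArg (fun m : R.obj N ⟶ R.obj (c.cell y.1) => m.hom v)
    (R.map_comp f (homOfLE (show M ≤ c.cell y.1 from y.2)))).symm

variable (k) in
/-- If all sheaves which are locally constant along the cells are conical, they are the same as the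
representations of the poset of cells. -/
theorem isEquivalence_starSections {Q : ObjectProperty (X.Sheaf (ModuleCat.{u} k))}
    (hQ : ∀ F, Q F ↔ ∀ M, LocConstOn F (c.cell ⁻¹' {M})) (hQ' : ∀ F, Q F → c.Conical F) :
    (Q.ι ⋙ c.starSections k).IsEquivalence where
  faithful := ⟨fun {F G f g} h => ObjectProperty.hom_ext _ ((hQ' _ F.property).hom_ext h)⟩
  full := ⟨fun {F G} η => by
    obtain ⟨f, hf⟩ := (hQ' _ F.property).exists_map_eq η
    exact ⟨ObjectProperty.homMk f, hf⟩⟩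
  essSurj := ⟨fun R => by
    have h := (hQ _).2 (c.propagatedSheaf_locConstOn_cell R)
    exact ⟨⟨_, h⟩, c.nonempty_starSections_iso R (hQ' _ h)⟩⟩

end PosetStratification

end PosetStratification

/-! ### Labellings and the order on contingency matrices. -/

section Labels

open Finset

/-- Two maps with fibres of the same cardinality differ by a permutation. -/
theorem exists_perm_of_card_fiber_eq {α β : Type*} [Fintype α] [DecidableEq β] {f g : α → β}
    (h : ∀ b, #{a | f a = b} = #{a | g a = b}) : ∃ π : Equiv.Perm α, ∀ a, g (π a) = f a := by
  have e : ∀ b, Nonempty ({a // f a = b} ≃ {a // g a = b}) := by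
    intro b
    rw [← Fintype.card_eq, Fintype.card_subtype, Fintype.card_subtype]
    exact h b
  exact ⟨Equiv.ofFiberEquiv fun b => (e b).some, Equiv.ofFiberEquiv_map _⟩

/-- A real-valued function on a finite type numbers its values increasingly. -/
theorem exists_strictMono_factorization {α : Type*} [Fintype α] (f : α → ℝ) :
    ∃ (p : ℕ) (x : Fin p → ℝ) (r : α → Fin p), StrictMono x ∧ Function.Surjective r ∧
      ∀ a, f a = x (r a) := by
  classical
  let e := (univ.image f).orderIsoOfFin rfl
  refine ⟨_, fun i => (e i).1, fun a => e.symm ⟨f a, mem_image_of_mem f (mem_univ a)⟩,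
    fun i j h => e.strictMono h, fun i => ?_, fun a => by simp⟩
  obtain ⟨a, -, ha⟩ := mem_image.1 (e i).2
  exact ⟨a, by rw [OrderIso.symm_apply_eq]; exact Subtype.ext ha⟩

namespace ContMat

variable {n : ℕ}

/-- A labelling of `n` points by rows and columns with the given multiplicities. -/
def IsLabelling {p q : ℕ} (m : Fin p → Fin q → ℕ) (r : Fin n → Fin p) (s : Fin n → Fin q) : Prop :=
  ∀ i j, m i j = #{ν | r ν = i ∧ s ν = j}

theorem IsLabelling.swap {p q : ℕ} {m : Fin p → Fin q → ℕ} {r : Fin n → Fin p} {s : Fin n → Fin q}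
    (h : IsLabelling m r s) : IsLabelling (fun j i => m i j) s r := fun i j =>
  (h j i).trans (congrArg card (filter_congr fun _ _ => and_comm))

theorem IsLabelling.merge {p q : ℕ} {m : Fin p → Fin q → ℕ} {r : Fin n → Fin p} {s : Fin n → Fin q}
    (h : IsLabelling m r s) (i : Fin (p - 1)) :
    IsLabelling (fun b j => ∑ a with merge i a = b, m a j) (fun ν => ContMat.merge i (r ν)) s := by
  intro b j
  dsimp only
  rw [card_eq_sum_card_fiberwise (f := r) (t := ({a | ContMat.merge i a = b} : Finset (Fin p)))
    (fun ν hν => by simpa using (mem_filter.1 hν).2.1)]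
  refine sum_congr rfl fun a ha => ?_
  rw [h a j, filter_filter]
  refine congrArg card (filter_congr fun ν _ => ?_)
  have ha' := (mem_filter.1 ha).2
  constructor
  · rintro ⟨rfl, h⟩
    exact ⟨⟨ha', h⟩, rfl⟩
  · rintro ⟨⟨-, h⟩, rfl⟩
    exact ⟨rfl, h⟩

/-- A labelling of `n` points by rows and columns with the multiplicities given by a contingency
matrix. -/
def IsLabel (M : ContMat n) (r : Fin n → Fin M.p) (s : Fin n → Fin M.q) : Prop :=
  IsLabelling M.m r s

theorem IsLabel.transpose {M : ContMat n} {r : Fin n → Fin M.p} {s : Fin n → Fin M.q}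
    (h : M.IsLabel r s) : M.transpose.IsLabel s r :=
  IsLabelling.swap h

theorem IsLabel.contrH {M : ContMat n} {r : Fin n → Fin M.p} {s : Fin n → Fin M.q}
    (h : M.IsLabel r s) (i : Fin (M.p - 1)) :
    (M.contrH i).IsLabel (fun ν => merge i (r ν)) s :=
  IsLabelling.merge h i

theorem IsLabel.contrV {M : ContMat n} {r : Fin n → Fin M.p} {s : Fin n → Fin M.q}
    (h : M.IsLabel r s) (i : Fin (M.q - 1)) :
    (M.contrV i).IsLabel r (fun ν => merge i (s ν)) :=
  (h.transpose.contrH i).transpose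

theorem IsLabel.fst_surjective {M : ContMat n} {r : Fin n → Fin M.p} {s : Fin n → Fin M.q}
    (h : M.IsLabel r s) : Function.Surjective r := by
  intro i
  obtain ⟨j, hj⟩ := M.fst_ne_zero i
  rw [h i j, card_ne_zero] at hj
  obtain ⟨ν, hν⟩ := hj
  exact ⟨ν, (mem_filter.1 hν).2.1⟩

theorem IsLabel.snd_surjective {M : ContMat n} {r : Fin n → Fin M.p} {s : Fin n → Fin M.q}
    (h : M.IsLabel r s) : Function.Surjective s :=
  h.transpose.fst_surjective

/-- The disjoint union of sets of `m i j` elements has `n` elements in all; number them. -/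
theorem exists_isLabel (M : ContMat n) : ∃ r s, M.IsLabel r s := by
  have hc : Fintype.card (Σ i : Fin M.p, Σ j : Fin M.q, Fin (M.m i j)) = Fintype.card (Fin n) := by
    simp [M.weight]
  let e := (Fintype.equivOfCardEq hc).symm
  refine ⟨fun ν => (e ν).1, fun ν => (e ν).2.1, fun i j => ?_⟩
  rw [← Fintype.card_fin (M.m i j), ← Finset.card_univ]
  have key : ∀ w : (Σ i : Fin M.p, Σ j : Fin M.q, Fin (M.m i j)), w.1 = i → w.2.1.val = j.val →
      ∃ c, (⟨i, j, c⟩ : Σ i : Fin M.p, Σ j : Fin M.q, Fin (M.m i j)) = w := by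
    rintro ⟨a, b, c⟩ rfl h
    obtain rfl : b = j := Fin.ext h
    exact ⟨c, rfl⟩
  refine card_bij (fun a _ => e.symm ⟨i, j, a⟩) (fun a _ => ?_) (fun a _ b _ h => ?_)
    fun ν hν => ?_
  · have h := e.apply_symm_apply ⟨i, j, a⟩
    rw [mem_filter]
    refine ⟨mem_univ _, ?_⟩
    dsimp only
    rw [h]
    exact ⟨rfl, rfl⟩
  · simpa using h
  · obtain ⟨h1, h2⟩ := (mem_filter.1 hν).2
    obtain ⟨c, hc⟩ := key (e ν) h1 (congrArg Fin.val h2)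
    exact ⟨c, mem_univ _, by rw [Equiv.symm_apply_eq, hc]⟩

theorem IsLabel.exists_perm {M : ContMat n} {r r' : Fin n → Fin M.p} {s s' : Fin n → Fin M.q}
    (h : M.IsLabel r s) (h' : M.IsLabel r' s') :
    ∃ π : Equiv.Perm (Fin n), ∀ ν, r' (π ν) = r ν ∧ s' (π ν) = s ν := by
  obtain ⟨π, hπ⟩ := exists_perm_of_card_fiber_eq (f := fun ν => (r ν, s ν))
    (g := fun ν => (r' ν, s' ν)) (by
      rintro ⟨i, j⟩
      simp only [Prod.mk.injEq]
      rw [← h i j, ← h' i j])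
  exact ⟨π, fun ν => by simpa using hπ ν⟩

theorem exists_merge_factorization {p p' : ℕ} {σ : Fin p → Fin p'} (hσ : Monotone σ)
    (hni : ¬ Function.Injective σ) :
    ∃ (i : Fin (p - 1)) (σ' : Fin (p - 1) → Fin p'), Monotone σ' ∧ ∀ a, σ a = σ' (merge i a) := by
  have h1 : ∃ a b : Fin p, a < b ∧ σ a = σ b := by
    simp only [Function.Injective, not_forall] at hni
    obtain ⟨a, b, h, hne⟩ := hni
    rcases lt_or_gt_of_ne hne with hl | hl
    · exact ⟨a, b, hl, h⟩
    · exact ⟨b, a, hl, h.symm⟩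
  obtain ⟨a, b, hab, h⟩ := h1
  have ha : a.val + 1 < p := by omega
  -- Monotonicity squeezes `σ (a + 1)` between the equal values `σ a` and `σ b`; so two neighbours
  -- are identified, and `σ'` below is `σ` with the place `a + 1` skipped.
  have hs : σ a = σ ⟨a.val + 1, ha⟩ :=
    le_antisymm (hσ (Fin.le_def.2 (by simp))) (h ▸ hσ (Fin.le_def.2 (by simpa using hab)))
  refine ⟨⟨a.val, by omega⟩, fun c => if hc : c.val ≤ a.val then σ ⟨c.val, by omega⟩
    else σ ⟨c.val + 1, by omega⟩, ?_, ?_⟩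
  · intro c d hcd
    have hcd' : c.val ≤ d.val := hcd
    dsimp only
    split_ifs <;> apply hσ <;> rw [Fin.le_def] <;> simp only <;> omega
  · intro c
    by_cases hc : c.val ≤ a.val
    · simp [merge, hc]
    · by_cases hc' : c.val = a.val + 1
      · have : c = ⟨a.val + 1, ha⟩ := Fin.ext hc'
        subst this
        simp [merge, hs]
      · have h2 : ¬ c.val - 1 ≤ a.val := by omega
        have h3 : c.val - 1 + 1 = c.val := by omega
        simp [merge, hc, h2, h3]

theorem eq_of_label_injective {M N : ContMat n} {r : Fin n → Fin M.p} {s : Fin n → Fin M.q}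
    {σ : Fin M.p → Fin N.p} {τ : Fin M.q → Fin N.q} (hM : M.IsLabel r s) (hσ : StrictMono σ)
    (hτ : StrictMono τ) (hN : N.IsLabel (fun ν => σ (r ν)) (fun ν => τ (s ν))) : N = M := by
  have hp : M.p = N.p := by
    simpa using Fintype.card_of_bijective ⟨hσ.injective,
      Function.Surjective.of_comp (g := r) hN.fst_surjective⟩
  have hq : M.q = N.q := by
    simpa using Fintype.card_of_bijective ⟨hτ.injective,
      Function.Surjective.of_comp (g := s) hN.snd_surjective⟩
  obtain ⟨p, q, m, h1, h2, h3⟩ := M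
  obtain ⟨p', q', m', h1', h2', h3'⟩ := N
  dsimp only at hp hq
  subst hp hq
  obtain rfl : σ = id := hσ.eq_id
  obtain rfl : τ = id := hτ.eq_id
  congr 1
  funext i j
  exact (hN i j).trans (hM i j).symm

/-- Induction on the size: a non-injective monotone relabelling factors through a merge of two
neighbours, which is one contraction. If both relabellings are injective, they are bijective since
no slice vanishes, hence identities. -/
theorem le_of_label {M : ContMat n} : ∀ {N : ContMat n} {r : Fin n → Fin M.p} {s : Fin n → Fin M.q}
    {σ : Fin M.p → Fin N.p} {τ : Fin M.q → Fin N.q}, M.IsLabel r s → Monotone σ →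
    Monotone τ → N.IsLabel (fun ν => σ (r ν)) (fun ν => τ (s ν)) → N ≤ M := by
  induction hw : M.p + M.q using Nat.strong_induction_on generalizing M with
  | _ w ih =>
  intro N r s σ τ hM hσ hτ hN
  by_cases hσi : Function.Injective σ
  · by_cases hτi : Function.Injective τ
    · exact (eq_of_label_injective hM (hσ.strictMono_of_injective hσi)
        (hτ.strictMono_of_injective hτi) hN).le
    · obtain ⟨i, τ', hτ', h⟩ := exists_merge_factorization hτ hτi
      have hl : (M.contrV i).p + (M.contrV i).q < w := by
        rw [← hw]
        exact IsContraction.size_lt (Or.inr ⟨i, rfl⟩)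
      refine le_trans (ih _ hl rfl (M := M.contrV i) (N := N) (σ := σ) (τ := τ')
        (hM.contrV i) hσ hτ' ?_) (M.contrV_le i)
      rw [funext fun ν => h (s ν)] at hN
      exact hN
  · obtain ⟨i, σ', hσ', h⟩ := exists_merge_factorization hσ hσi
    have hl : (M.contrH i).p + (M.contrH i).q < w := by
      rw [← hw]
      exact IsContraction.size_lt (Or.inl ⟨i, rfl⟩)
    refine le_trans (ih _ hl rfl (M := M.contrH i) (N := N) (σ := σ') (τ := τ)
      (hM.contrH i) hσ' hτ ?_) (M.contrH_le i)
    rw [funext fun ν => h (r ν)] at hN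
    exact hN

end ContMat

end Labels

/-! ### Ordered configurations and their degenerations. -/

section Configurations

open Finset

variable {n : ℕ}

theorem symMk_eq_iff {ζ ξ : Fin n → ℂ} :
    symMk ζ = symMk ξ ↔ ∃ π : Equiv.Perm (Fin n), ∀ ν, ξ (π ν) = ζ ν := by
  classical
  constructor
  · intro h
    have h1 : Finset.univ.val.map ζ = Finset.univ.val.map ξ := congrArg Subtype.val h
    refine exists_perm_of_card_fiber_eq fun b => ?_
    have h2 := congrArg (Multiset.count b) h1
    rw [Multiset.count_map, Multiset.count_map] at h2
    have h3 : ∀ f : Fin n → ℂ, #{a | f a = b} =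
        Multiset.card (Multiset.filter (fun a => b = f a) Finset.univ.val) := fun f => by
      rw [← Finset.filter_val, ← Finset.card_def]
      exact congrArg card (filter_congr fun _ _ => eq_comm)
    rw [h3, h3, h2]
  · rintro ⟨π, hπ⟩
    refine Subtype.ext ?_
    change Finset.univ.val.map ζ = Finset.univ.val.map ξ
    have h1 : ζ = ξ ∘ π := funext fun ν => (hπ ν).symm
    rw [h1, ← Multiset.map_map]
    congr 1
    exact congrArg Finset.val (Finset.map_univ_equiv π)

theorem symMk_surjective : Function.Surjective (symMk : (Fin n → ℂ) → Sym ℂ n) := by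
  rintro ⟨s, hs⟩
  induction s using Quotient.inductionOn with
  | _ l =>
    have hl : l.length = n := hs
    subst hl
    refine ⟨l.get, Subtype.ext ?_⟩
    change Finset.univ.val.map l.get = _
    rw [Fin.univ_val_map, List.ofFn_get]
    rfl

theorem continuous_symMk : Continuous (symMk : (Fin n → ℂ) → Sym ℂ n) :=
  continuous_coinduced_rng

/-- The saturation of an open set is the union of its preimages under the coordinate permutations.
-/
theorem isOpenMap_symMk : IsOpenMap (symMk : (Fin n → ℂ) → Sym ℂ n) := by
  intro U hU
  rw [isOpen_coinduced]
  have h : symMk ⁻¹' (symMk '' U) =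
      ⋃ π : Equiv.Perm (Fin n), (fun ζ : Fin n → ℂ => fun ν => ζ (π ν)) ⁻¹' U := by
    ext ζ
    simp only [Set.mem_preimage, Set.mem_image, Set.mem_iUnion]
    constructor
    · rintro ⟨ξ, hξ, h⟩
      obtain ⟨π, hπ⟩ := symMk_eq_iff.1 h
      exact ⟨π, by rwa [funext hπ]⟩
    · rintro ⟨π, hπ⟩
      exact ⟨_, hπ, symMk_eq_iff.2 ⟨π, fun _ => rfl⟩⟩
  rw [h]
  exact isOpen_iUnion fun π => hU.preimage (by fun_prop)

/-- An ordered configuration of points lies over the contingency cell of a matrix. -/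
def IsPlaced (M : ContMat n) (ζ : Fin n → ℂ) : Prop :=
  ∃ (x : Fin M.p → ℝ) (y : Fin M.q → ℝ) (r : Fin n → Fin M.p) (s : Fin n → Fin M.q),
    StrictMono x ∧ StrictMono y ∧ M.IsLabel r s ∧
      (∀ ν, (ζ ν).re = x (r ν)) ∧ ∀ ν, (ζ ν).im = y (s ν)

theorem symMk_mem_contCell_iff {M : ContMat n} {ζ : Fin n → ℂ} :
    symMk ζ ∈ contCell n M ↔ IsPlaced M ζ := by
  classical
  have hmem : ∀ w, w ∈ pts (symMk ζ) ↔ ∃ ν, ζ ν = w := fun w => by simp [pts, symMk]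
  have hc : ∀ P : ℂ → Prop, ∀ [DecidablePred P], (pts (symMk ζ)).countP P = #{ν | P (ζ ν)} := by
    intro P _
    change (Finset.univ.val.map ζ).countP P = _
    rw [Multiset.countP_map]
    rfl
  constructor
  · rintro ⟨x, y, hx, hy, hrx, hry, hm⟩
    have h1 : ∀ ν, ∃ i, x i = (ζ ν).re := fun ν => by
      have : (ζ ν).re ∈ Set.range x := hrx ▸ ⟨_, (hmem _).2 ⟨ν, rfl⟩, rfl⟩
      exact this
    have h2 : ∀ ν, ∃ i, y i = (ζ ν).im := fun ν => by
      have : (ζ ν).im ∈ Set.range y := hry ▸ ⟨_, (hmem _).2 ⟨ν, rfl⟩, rfl⟩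
      exact this
    choose r hr using h1
    choose s hs using h2
    refine ⟨x, y, r, s, hx, hy, fun i j => ?_, fun ν => (hr ν).symm, fun ν => (hs ν).symm⟩
    rw [hm i j, hc]
    refine congrArg card (filter_congr fun ν _ => ?_)
    rw [← hr, ← hs, hx.injective.eq_iff, hy.injective.eq_iff]
  · rintro ⟨x, y, r, s, hx, hy, hl, hr, hs⟩
    refine ⟨x, y, hx, hy, ?_, ?_, fun i j => ?_⟩
    · ext t
      constructor
      · rintro ⟨i, rfl⟩
        obtain ⟨ν, rfl⟩ := hl.fst_surjective i
        exact ⟨_, (hmem _).2 ⟨ν, rfl⟩, hr ν⟩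
      · rintro ⟨w, hw, rfl⟩
        obtain ⟨ν, rfl⟩ := (hmem _).1 hw
        exact ⟨_, (hr ν).symm⟩
    · ext t
      constructor
      · rintro ⟨i, rfl⟩
        obtain ⟨ν, rfl⟩ := hl.snd_surjective i
        exact ⟨_, (hmem _).2 ⟨ν, rfl⟩, hs ν⟩
      · rintro ⟨w, hw, rfl⟩
        obtain ⟨ν, rfl⟩ := (hmem _).1 hw
        exact ⟨_, (hs ν).symm⟩
    · rw [hl i j, hc]
      refine congrArg card (filter_congr fun ν _ => ?_)
      rw [hr, hs, hx.injective.eq_iff, hy.injective.eq_iff]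

theorem IsPlaced.swap {M : ContMat n} {ζ : Fin n → ℂ} (h : IsPlaced M ζ) :
    IsPlaced M.transpose (fun ν => swapReIm (ζ ν)) := by
  obtain ⟨x, y, r, s, hx, hy, hl, hr, hs⟩ := h
  exact ⟨y, x, s, r, hy, hx, hl.transpose, hs, hr⟩

theorem exists_isPlaced_of_contMat (M : ContMat n) : ∃ ζ, IsPlaced M ζ := by
  obtain ⟨r, s, h⟩ := M.exists_isLabel
  exact ⟨fun ν => ⟨(r ν).val, (s ν).val⟩, fun i => i.val, fun j => j.val, r, s,
    fun i j hij => Nat.cast_lt.2 hij, fun i j hij => Nat.cast_lt.2 hij, h, fun _ => rfl,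
    fun _ => rfl⟩

theorem exists_isPlaced (ζ : Fin n → ℂ) : ∃ M, IsPlaced M ζ := by
  obtain ⟨p, x, r, hx, hr, hxr⟩ := exists_strictMono_factorization fun ν => (ζ ν).re
  obtain ⟨q, y, s, hy, hs, hys⟩ := exists_strictMono_factorization fun ν => (ζ ν).im
  refine ⟨⟨p, q, fun i j => #{ν | r ν = i ∧ s ν = j}, fun i => ?_, fun j => ?_, ?_⟩,
    x, y, r, s, hx, hy, fun _ _ => rfl, hxr, hys⟩
  · obtain ⟨ν, rfl⟩ := hr i
    exact ⟨s ν, card_ne_zero.2 ⟨ν, by simp⟩⟩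
  · obtain ⟨ν, rfl⟩ := hs j
    exact ⟨r ν, card_ne_zero.2 ⟨ν, by simp⟩⟩
  · have h1 : ∀ i, ∑ j, #{ν | r ν = i ∧ s ν = j} = #{ν | r ν = i} := by
      intro i
      rw [card_eq_sum_card_fiberwise (f := s) (t := univ) (fun _ _ => by simp)]
      exact sum_congr rfl fun j _ => by rw [filter_filter]
    simp only [h1]
    rw [← card_eq_sum_card_fiberwise (f := r) (s := univ) (t := univ) (fun _ _ => by simp)]
    simp

/-- The ordered configuration `ζ` is a degeneration of `ξ`: strict inequalities between real or
imaginary parts in `ζ` persist in `ξ`. -/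
def Degen (ζ ξ : Fin n → ℂ) : Prop :=
  ∀ ν μ, ((ζ ν).re < (ζ μ).re → (ξ ν).re < (ξ μ).re) ∧ ((ζ ν).im < (ζ μ).im → (ξ ν).im < (ξ μ).im)

theorem Degen.refl (ζ : Fin n → ℂ) : Degen ζ ζ := fun _ _ => ⟨id, id⟩

theorem Degen.trans {ζ ξ χ : Fin n → ℂ} (h : Degen ζ ξ) (h' : Degen ξ χ) : Degen ζ χ :=
  fun ν μ => ⟨fun a => (h' ν μ).1 ((h ν μ).1 a), fun a => (h' ν μ).2 ((h ν μ).2 a)⟩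

theorem Degen.swap {ζ ξ : Fin n → ℂ} (h : Degen ζ ξ) :
    Degen (fun ν => swapReIm (ζ ν)) (fun ν => swapReIm (ξ ν)) := fun ν μ =>
  ⟨(h ν μ).2, (h ν μ).1⟩

theorem Degen.comp {ζ ξ : Fin n → ℂ} (h : Degen ζ ξ) (π : Equiv.Perm (Fin n)) :
    Degen (fun ν => ζ (π ν)) (fun ν => ξ (π ν)) := fun ν μ => h (π ν) (π μ)

theorem Degen.re_eq {ζ ξ : Fin n → ℂ} (h : Degen ζ ξ) {ν μ : Fin n} (e : (ξ ν).re = (ξ μ).re) :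
    (ζ ν).re = (ζ μ).re := by
  rcases lt_trichotomy (ζ ν).re (ζ μ).re with hl | hl | hl
  · exact absurd ((h ν μ).1 hl) (by rw [e]; exact lt_irrefl _)
  · exact hl
  · exact absurd ((h μ ν).1 hl) (by rw [e]; exact lt_irrefl _)

theorem Degen.im_eq {ζ ξ : Fin n → ℂ} (h : Degen ζ ξ) {ν μ : Fin n} (e : (ξ ν).im = (ξ μ).im) :
    (ζ ν).im = (ζ μ).im :=
  h.swap.re_eq e

theorem exists_monotone_of_re {p p' : ℕ} {x : Fin p → ℝ} {x' : Fin p' → ℝ} {r : Fin n → Fin p}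
    {r' : Fin n → Fin p'} (hx : StrictMono x) (hx' : StrictMono x') (hr' : Function.Surjective r')
    (h : ∀ ν μ, x (r ν) < x (r μ) → x' (r' ν) < x' (r' μ)) :
    ∃ σ : Fin p' → Fin p, Monotone σ ∧ ∀ ν, σ (r' ν) = r ν := by
  have hle : ∀ ν μ, r' ν ≤ r' μ → r ν ≤ r μ := by
    intro ν μ hle
    by_contra hlt
    have h1 := h μ ν (hx (not_le.1 hlt))
    exact absurd (hx'.lt_iff_lt.1 h1) (not_lt.2 hle)
  choose c hc using hr'
  refine ⟨fun i => r (c i), fun i j hij => hle _ _ (by rwa [hc, hc]), fun ν => ?_⟩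
  exact le_antisymm (hle _ _ (hc _).le) (hle _ _ (hc _).ge)

/-- Points sharing a line in `ξ` share one in `ζ`, so the labels of `ζ` are monotone functions of
those of `ξ`. -/
theorem Degen.le {N M : ContMat n} {ζ ξ : Fin n → ℂ} (h : Degen ζ ξ) (hζ : IsPlaced N ζ)
    (hξ : IsPlaced M ξ) : N ≤ M := by
  obtain ⟨x, y, r, s, hx, hy, hl, hr, hs⟩ := hζ
  obtain ⟨x', y', r', s', hx', hy', hl', hr', hs'⟩ := hξ
  obtain ⟨σ, hσ, hσr⟩ := exists_monotone_of_re (r := r) (r' := r') hx hx' hl'.fst_surjective fun ν μ => by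
    rw [← hr, ← hr, ← hr', ← hr']
    exact (h ν μ).1
  obtain ⟨τ, hτ, hτs⟩ := exists_monotone_of_re (r := s) (r' := s') hy hy' hl'.snd_surjective fun ν μ => by
    rw [← hs, ← hs, ← hs', ← hs']
    exact (h ν μ).2
  refine ContMat.le_of_label hl' hσ hτ ?_
  rwa [funext hσr, funext hτs]

theorem IsPlaced.unique {N M : ContMat n} {ζ : Fin n → ℂ} (h : IsPlaced N ζ) (h' : IsPlaced M ζ) :
    N = M :=
  le_antisymm ((Degen.refl ζ).le h h') ((Degen.refl ζ).le h' h)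

theorem merge_monotone {p : ℕ} (i : Fin (p - 1)) : Monotone (ContMat.merge i) := by
  intro a b hab
  have hab' : a.val ≤ b.val := hab
  rw [Fin.le_def]
  unfold ContMat.merge
  split_ifs <;> simp only <;> omega

/-- Each merged line is put at the position of one of its constituents, chosen by a section of
`merge i`. The preservation of imaginary parts is what the Fox–Neuwirth–Fuchs cells require. -/
theorem IsPlaced.exists_contrH {M : ContMat n} {ξ : Fin n → ℂ} (h : IsPlaced M ξ)
    (i : Fin (M.p - 1)) :
    ∃ ζ, IsPlaced (M.contrH i) ζ ∧ Degen ζ ξ ∧ ∀ ν, (ζ ν).im = (ξ ν).im := by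
  obtain ⟨x, y, r, s, hx, hy, hl, hr, hs⟩ := h
  choose c hc using ContMat.merge_surjective i
  have hcm : StrictMono c := by
    intro b b' hb
    by_contra hle
    have h1 := merge_monotone i (not_lt.1 hle)
    rw [hc, hc] at h1
    exact absurd hb (not_lt.2 h1)
  refine ⟨fun ν => ⟨x (c (ContMat.merge i (r ν))), y (s ν)⟩,
    ⟨fun b => x (c b), y, _, s, hx.comp hcm, hy, hl.contrH i, fun _ => rfl, fun _ => rfl⟩,
    fun ν μ => ⟨fun hlt => ?_, fun hlt => ?_⟩, fun ν => (hs ν).symm⟩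
  · rw [hr, hr]
    have h1 : ContMat.merge i (r ν) < ContMat.merge i (r μ) := (hx.comp hcm).lt_iff_lt.1 hlt
    by_contra hle
    exact absurd h1 (not_lt.2 (merge_monotone i (hx.le_iff_le.1 (not_lt.1 hle))))
  · rwa [hs, hs]

theorem IsPlaced.exists_contrV {M : ContMat n} {ξ : Fin n → ℂ} (h : IsPlaced M ξ)
    (j : Fin (M.q - 1)) : ∃ ζ, IsPlaced (M.contrV j) ζ ∧ Degen ζ ξ := by
  obtain ⟨ζ, hζ, hd, -⟩ := h.swap.exists_contrH j
  exact ⟨_, hζ.swap, hd.swap⟩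

theorem IsPlaced.exists_degen {N M : ContMat n} (hle : N ≤ M) {ξ : Fin n → ℂ} (h : IsPlaced M ξ) :
    ∃ ζ, IsPlaced N ζ ∧ Degen ζ ξ := by
  have hle' : Relation.ReflTransGen ContMat.IsContraction M N := hle
  induction hle' with
  | refl => exact ⟨ξ, h, .refl ξ⟩
  | @tail L N hML hLN ih =>
    obtain ⟨ζ, hζ, hd⟩ := ih hML
    rcases hLN with ⟨i, rfl⟩ | ⟨j, rfl⟩
    · obtain ⟨χ, hχ, hd', -⟩ := hζ.exists_contrH i
      exact ⟨χ, hχ, hd'.trans hd⟩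
    · obtain ⟨χ, hχ, hd'⟩ := hζ.exists_contrV j
      exact ⟨χ, hχ, hd'.trans hd⟩

/-- Labellings with the same multiplicities differ by a permutation, and strict inequalities between
coordinates depend only on labels. -/
theorem IsPlaced.exists_perm {N : ContMat n} {ζ ξ : Fin n → ℂ} (hζ : IsPlaced N ζ)
    (hξ : IsPlaced N ξ) :
    ∃ π : Equiv.Perm (Fin n), Degen ζ (fun ν => ξ (π ν)) ∧ Degen (fun ν => ξ (π ν)) ζ := by
  obtain ⟨x, y, r, s, hx, hy, hl, hr, hs⟩ := hζ
  obtain ⟨x', y', r', s', hx', hy', hl', hr', hs'⟩ := hξ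
  obtain ⟨π, hπ⟩ := hl.exists_perm hl'
  have h1 : ∀ ν, (ξ (π ν)).re = x' (r ν) := fun ν => by rw [hr', (hπ ν).1]
  have h2 : ∀ ν, (ξ (π ν)).im = y' (s ν) := fun ν => by rw [hs', (hπ ν).2]
  refine ⟨π, fun ν μ => ?_, fun ν μ => ?_⟩ <;>
    simp only [h1, h2, hr, hs, hx.lt_iff_lt, hy.lt_iff_lt, hx'.lt_iff_lt, hy'.lt_iff_lt] <;>
    exact ⟨id, id⟩

/-- If `N ≤ M`, every ordered configuration of type `N` is a degeneration of a reordering of any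
given one of type `M`. -/
theorem exists_perm_degen {N M : ContMat n} (hle : N ≤ M) {ζ ξ : Fin n → ℂ} (hζ : IsPlaced N ζ)
    (hξ : IsPlaced M ξ) : ∃ π : Equiv.Perm (Fin n), Degen ζ (fun ν => ξ (π ν)) := by
  obtain ⟨χ, hχ, hd⟩ := hξ.exists_degen hle
  obtain ⟨π, h1, -⟩ := hζ.exists_perm hχ
  exact ⟨π, h1.trans (hd.comp π)⟩

theorem isOpen_degen (ζ : Fin n → ℂ) : IsOpen {ξ | Degen ζ ξ} := by
  have h : {ξ | Degen ζ ξ} = ⋂ ν, ⋂ μ,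
      ({ξ : Fin n → ℂ | (ζ ν).re < (ζ μ).re → (ξ ν).re < (ξ μ).re} ∩
        {ξ : Fin n → ℂ | (ζ ν).im < (ζ μ).im → (ξ ν).im < (ξ μ).im}) := by
    ext ξ
    simp [Degen]
  rw [h]
  refine isOpen_iInter_of_finite fun ν => isOpen_iInter_of_finite fun μ => IsOpen.inter ?_ ?_
  · by_cases hl : (ζ ν).re < (ζ μ).re
    · simp only [hl, true_imp_iff]
      exact isOpen_lt (by fun_prop) (by fun_prop)
    · simp [hl]
  · by_cases hl : (ζ ν).im < (ζ μ).im
    · simp only [hl, true_imp_iff]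
      exact isOpen_lt (by fun_prop) (by fun_prop)
    · simp [hl]

theorem re_ray (ζ ξ : Fin n → ℂ) (t : ℝ) (ν : Fin n) :
    (ray ζ ξ t ν).re = (ζ ν).re + t * ((ξ ν).re - (ζ ν).re) := by
  simp [ray]

theorem im_ray (ζ ξ : Fin n → ℂ) (t : ℝ) (ν : Fin n) :
    (ray ζ ξ t ν).im = (ζ ν).im + t * ((ξ ν).im - (ζ ν).im) := by
  simp [ray]

theorem Degen.ray {ζ ξ : Fin n → ℂ} (h : Degen ζ ξ) {t : ℝ} (h0 : 0 ≤ t) (h1 : t ≤ 1) :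
    Degen ζ (ray ζ ξ t) := by
  have key : ∀ a b c d : ℝ, a < b → c < d → a + t * (c - a) < b + t * (d - b) := by
    intro a b c d hab hcd
    rcases eq_or_lt_of_le h0 with rfl | h0
    · linarith
    · nlinarith
  intro ν μ
  rw [re_ray, re_ray, im_ray, im_ray]
  exact ⟨fun hl => key _ _ _ _ hl ((h ν μ).1 hl), fun hl => key _ _ _ _ hl ((h ν μ).2 hl)⟩

/-- A strict inequality in `ξ` is at least weak in `ζ`, so it is strict at every positive time. With
`Degen.ray_degen`, this shows that the ray lies in the cell of `ξ` for `0 < t ≤ 1`. -/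
theorem Degen.degen_ray {ζ ξ : Fin n → ℂ} (h : Degen ζ ξ) {t : ℝ} (h0 : 0 < t) (h1 : t ≤ 1) :
    Degen ξ (_root_.ray ζ ξ t) := by
  have key : ∀ a b c d : ℝ, (b < a → d < c) → c < d → a + t * (c - a) < b + t * (d - b) := by
    intro a b c d hab hcd
    have hab' : a ≤ b := not_lt.1 fun hl => absurd (hab hl) (not_lt.2 hcd.le)
    nlinarith
  intro ν μ
  rw [re_ray, re_ray, im_ray, im_ray]
  exact ⟨fun hl => key _ _ _ _ (h μ ν).1 hl, fun hl => key _ _ _ _ (h μ ν).2 hl⟩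

theorem Degen.ray_degen {ζ ξ : Fin n → ℂ} (h : Degen ζ ξ) {t : ℝ} (h0 : 0 ≤ t) (h1 : t ≤ 1) :
    Degen (_root_.ray ζ ξ t) ξ := by
  have key : ∀ a b c d : ℝ, (b < a → d < c) → (a < b → c < d) → a + t * (c - a) < b + t * (d - b) →
      c < d := by
    intro a b c d hba hab hl
    rcases lt_trichotomy a b with h | rfl | h
    · exact hab h
    · by_contra hcd
      nlinarith
    · have := hba h
      nlinarith
  intro ν μ
  rw [re_ray, re_ray, im_ray, im_ray]
  exact ⟨key _ _ _ _ (h μ ν).1 (h ν μ).1, key _ _ _ _ (h μ ν).2 (h ν μ).2⟩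

/-- After sorting by `g`, both `f` and `f ∘ π` become monotone, and a monotone rearrangement of
given values is unique. -/
theorem eq_of_perm_of_sorted {f g : Fin n → ℝ} {π : Equiv.Perm (Fin n)}
    (hf : ∀ ν μ, f ν < f μ → g ν < g μ) (hf' : ∀ ν μ, f (π ν) < f (π μ) → g ν < g μ) (ν : Fin n) :
    f (π ν) = f ν := by
  have h1 : Monotone (f ∘ Tuple.sort g) := fun a b hab => by
    by_contra hl
    exact absurd (hf _ _ (not_le.1 hl)) (not_lt.2 (Tuple.monotone_sort g hab))
  have h2 : Monotone (f ∘ (Tuple.sort g).trans π) := fun a b hab => by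
    by_contra hl
    exact absurd (hf' _ _ (not_le.1 hl)) (not_lt.2 (Tuple.monotone_sort g hab))
  have h3 := congrFun (Tuple.unique_monotone h2 h1) ((Tuple.sort g).symm ν)
  simpa using h3

/-- Two orderings of one configuration that are both degenerations of the same `ξ` coincide, so the
ray from `ζ` to an unordered configuration is well defined. -/
theorem Degen.eq_of_perm {ζ ξ : Fin n → ℂ} {π : Equiv.Perm (Fin n)} (h : Degen ζ ξ)
    (h' : Degen (fun ν => ζ (π ν)) ξ) (ν : Fin n) : ζ (π ν) = ζ ν :=
  Complex.ext
    (eq_of_perm_of_sorted (f := fun ν => (ζ ν).re) (g := fun ν => (ξ ν).re)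
      (fun ν μ => (h ν μ).1) (fun ν μ => (h' ν μ).1) ν)
    (eq_of_perm_of_sorted (f := fun ν => (ζ ν).im) (g := fun ν => (ξ ν).im)
      (fun ν μ => (h ν μ).2) (fun ν μ => (h' ν μ).2) ν)

end Configurations

/-! ### The contingency cells as a stratification by a poset. -/

section ContingencyStratification

open Opposite Topology

variable {k : Type u} [Field k] {n : ℕ}

/-- The quotient map from ordered to unordered configurations. -/
def symPoint (ζ : Fin n → ℂ) : SymSpace.{u} n := ULift.up (symMk ζ)

theorem continuous_symPoint : Continuous (symPoint.{u} : (Fin n → ℂ) → SymSpace.{u} n) :=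
  continuous_uliftUp.comp continuous_symMk

theorem isOpenMap_symPoint : IsOpenMap (symPoint.{u} : (Fin n → ℂ) → SymSpace.{u} n) :=
  Homeomorph.ulift.symm.isOpenMap.comp isOpenMap_symMk

theorem symPoint_surjective :
    Function.Surjective (symPoint.{u} : (Fin n → ℂ) → SymSpace.{u} n) := fun z => by
  obtain ⟨ζ, h⟩ := symMk_surjective z.down
  exact ⟨ζ, ULift.ext _ _ h⟩

theorem symPoint_eq_iff {ζ ξ : Fin n → ℂ} :
    symPoint.{u} ζ = symPoint ξ ↔ ∃ π : Equiv.Perm (Fin n), ∀ ν, ξ (π ν) = ζ ν :=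
  ULift.up_inj.trans symMk_eq_iff

theorem exists_mem_contCell (z : Sym ℂ n) : ∃ M, z ∈ contCell n M := by
  obtain ⟨ζ, rfl⟩ := symMk_surjective z
  obtain ⟨M, hM⟩ := exists_isPlaced ζ
  exact ⟨M, symMk_mem_contCell_iff.2 hM⟩

theorem contCell_unique {z : Sym ℂ n} {N M : ContMat n} (hN : z ∈ contCell n N)
    (hM : z ∈ contCell n M) : N = M := by
  obtain ⟨ζ, rfl⟩ := symMk_surjective z
  exact (symMk_mem_contCell_iff.1 hN).unique (symMk_mem_contCell_iff.1 hM)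

/-- The contingency matrix of an unordered configuration. -/
noncomputable def contType (z : SymSpace.{u} n) : ContMat n := (exists_mem_contCell z.down).choose

theorem contType_eq_iff {z : SymSpace.{u} n} {M : ContMat n} :
    contType z = M ↔ z.down ∈ contCell n M :=
  ⟨fun h => h ▸ (exists_mem_contCell z.down).choose_spec,
    contCell_unique (exists_mem_contCell z.down).choose_spec⟩

theorem contType_symPoint_eq_iff {ζ : Fin n → ℂ} {M : ContMat n} :
    contType (symPoint.{u} ζ) = M ↔ IsPlaced M ζ :=
  contType_eq_iff.trans symMk_mem_contCell_iff

theorem isPlaced_contType (ζ : Fin n → ℂ) : IsPlaced (contType (symPoint.{u} ζ)) ζ :=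
  contType_symPoint_eq_iff.1 rfl

theorem Degen.contType_le {ζ ξ : Fin n → ℂ} (h : Degen ζ ξ) :
    contType (symPoint.{u} ζ) ≤ contType (symPoint.{u} ξ) :=
  h.le (isPlaced_contType ζ) (isPlaced_contType ξ)

theorem le_contType_iff {ζ : Fin n → ℂ} {M : ContMat n} (hζ : IsPlaced M ζ) {z : SymSpace.{u} n} :
    M ≤ contType z ↔ ∃ ξ, Degen ζ ξ ∧ symPoint ξ = z := by
  constructor
  · intro h
    obtain ⟨ξ, rfl⟩ := symPoint_surjective z
    obtain ⟨π, hπ⟩ := exists_perm_degen h hζ (isPlaced_contType ξ)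
    exact ⟨_, hπ, symPoint_eq_iff.2 ⟨π, fun _ => rfl⟩⟩
  · rintro ⟨ξ, h, rfl⟩
    exact h.le hζ (isPlaced_contType ξ)

variable (n) in
/-- The stratification of the symmetric product by contingency cells. -/
noncomputable def contStratification : PosetStratification (SymSpace.{u} n) (ContMat n) where
  cell := contType
  isOpen_le M := by
    obtain ⟨ζ, hζ⟩ := exists_isPlaced_of_contMat M
    have h : {z : SymSpace.{u} n | M ≤ contType z} = symPoint '' {ξ | Degen ζ ξ} := by
      ext z
      exact le_contType_iff hζ
    rw [h]
    exact isOpenMap_symPoint _ (isOpen_degen ζ)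
  surjective M := by
    obtain ⟨ζ, hζ⟩ := exists_isPlaced_of_contMat M
    exact ⟨symPoint ζ, contType_symPoint_eq_iff.2 hζ⟩

theorem contStratification_cell_preimage (M : ContMat n) :
    (contStratification.{u} n).cell ⁻¹' {M} = ULift.down ⁻¹' contCell n M := by
  ext z
  exact contType_eq_iff

theorem contStratification_cell_eq {z : SymSpace.{u} n} {M : ContMat n} (h : z.down ∈ contCell n M) :
    (contStratification.{u} n).cell z = M := contType_eq_iff.2 h

theorem mem_star_of_mem_contCell {z : SymSpace.{u} n} {M : ContMat n} (h : z.down ∈ contCell n M) :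
    z ∈ (contStratification.{u} n).star M := (contStratification_cell_eq h).ge

theorem constructible_iff {ι : Type} {S : ι → Set (Sym ℂ n)}
    {F : (SymSpace.{u} n).Sheaf (ModuleCat.{u} k)} :
    constructible k S F ↔ ∀ a, LocConstOn F (ULift.down ⁻¹' S a : Set (SymSpace.{u} n)) :=
  forall_congr' fun _ => isLocConstSheaf_restrictSheaf_iff F _

theorem constructible_contCell_iff {F : (SymSpace.{u} n).Sheaf (ModuleCat.{u} k)} :
    constructible k (contCell n) F ↔ ∀ M, LocConstOn F ((contStratification.{u} n).cell ⁻¹' {M}) :=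
  constructible_iff.trans (forall_congr' fun M =>
    iff_of_eq (congrArg (LocConstOn F) (contStratification_cell_preimage M).symm))

theorem Degen.symPoint_ray_eq {ζ ξ ξ' : Fin n → ℂ} (h : Degen ζ ξ) (h' : Degen ζ ξ')
    (e : symPoint.{u} ξ = symPoint ξ') (t : ℝ) :
    symPoint.{u} (_root_.ray ζ ξ t) = symPoint (_root_.ray ζ ξ' t) := by
  obtain ⟨π, hπ⟩ := symPoint_eq_iff.1 e
  have h2 := h'.comp π
  rw [funext hπ] at h2
  refine symPoint_eq_iff.2 ⟨π, fun ν => ?_⟩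
  change ζ (π ν) + t • (ξ' (π ν) - ζ (π ν)) = ζ ν + t • (ξ ν - ζ ν)
  rw [hπ, h.eq_of_perm h2]

/-- The cone of configurations degenerating to `ζ` satisfies all requirements of
`bijective_germ_of_cone`, with the cell of `ξ` as the stratum containing the ray to `ξ` minus its
apex. -/
theorem conical_of_constructible {F : (SymSpace.{u} n).Sheaf (ModuleCat.{u} k)}
    (hF : constructible k (contCell n) F) : (contStratification.{u} n).Conical F := by
  rw [constructible_contCell_iff] at hF
  intro z
  obtain ⟨ζ, rfl⟩ := symPoint_surjective z
  refine bijective_germ_of_cone continuous_symPoint isOpenMap_symPoint (isOpen_degen ζ)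
    (Degen.refl ζ) (fun ξ hξ t h0 h1 => hξ.ray h0 h1)
    (fun ξ hξ => ⟨_, hF (contType (symPoint ξ)), fun t h0 h1 => ?_⟩)
    (fun ξ hξ ξ' hξ' e t => hξ.symPoint_ray_eq hξ' e t) _ (fun z => ?_) _
  · exact le_antisymm (hξ.ray_degen h0.le h1).contType_le (hξ.degen_ray h0 h1).contType_le
  · exact le_contType_iff (isPlaced_contType ζ)

variable (k n) in
/-- The functor taking sections over the open stars of the contingency cells. -/
noncomputable def stalkFunctorCont : ConstrSh.{u} k (contCell n) ⥤ ContRep.{u} k n :=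
  (constructible k (contCell n)).ι ⋙ (contStratification.{u} n).starSections k

instance : (stalkFunctorCont.{u} k n).IsEquivalence :=
  PosetStratification.isEquivalence_starSections k _ (fun _ => constructible_contCell_iff)
    fun _ => conical_of_constructible

-- The stalk isomorphisms are the germ maps from the stars. A section with the same germ at `z` as a
-- star section agrees with it near `z`, and restriction to a smaller star does not change germs.
open PosetStratification in
theorem isStalkRep_stalkFunctorCont : IsStalkRep (stalkFunctorCont.{u} k n) := by
  let c := contStratification.{u} n
  have hbij : ∀ (F : ConstrSh.{u} k (contCell n)) (M : ContMat n) (z : SymSpace.{u} n)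
      (hz : z.down ∈ contCell n M),
      Function.Bijective (F.obj.presheaf.germ (c.star M) z (mem_star_of_mem_contCell hz)) :=
    fun F M z hz => (conical_of_constructible F.property).bijective_germ
      (contStratification_cell_eq hz) _
  have hiso : ∀ (F : ConstrSh.{u} k (contCell n)) (M : ContMat n) (z : SymSpace.{u} n)
      (hz : z.down ∈ contCell n M),
      IsIso (F.obj.presheaf.germ (c.star M) z (mem_star_of_mem_contCell hz)) :=
    fun F M z hz => (ConcreteCategory.isIso_iff_bijective _).2 (hbij F M z hz)
  refine ⟨fun F M z hz => @asIso _ _ _ _ _ (hiso F M z hz), fun F G f M z hz => ?_,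
    fun F N M h z hz U hzU s v hv => ?_⟩
  · exact (TopCat.Presheaf.stalkFunctor_map_germ (c.star M) z (mem_star_of_mem_contCell hz)
      f.hom.hom).symm
  · obtain ⟨V, hzV, i, j, hV⟩ := F.obj.presheaf.germ_eq z (mem_star_of_mem_contCell hz) hzU v s hv
    refine ⟨V, hzV, leOfHom j, fun w hwV hw => ?_⟩
    refine (TopCat.Presheaf.germ_res_apply F.obj.presheaf (homOfLE (c.star_le h)) w
      (mem_star_of_mem_contCell hw) v).trans ?_
    refine (TopCat.Presheaf.germ_res_apply F.obj.presheaf i w hwV v).symm.trans ?_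
    exact (congrArg _ hV).trans (TopCat.Presheaf.germ_res_apply F.obj.presheaf j w hwV s)

/-- The ray from a configuration of type `N` to one of type `M` supplies the path: it starts in the
first cell and lies in the second at all positive times. -/
theorem bijective_res_of_locConstOn {F : (SymSpace.{u} n).Sheaf (ModuleCat.{u} k)}
    (hF : constructible k (contCell n) F) {S : Set (SymSpace.{u} n)} (hS : LocConstOn F S)
    {N M : ContMat n} (h : N ≤ M) (hN : ∀ z : SymSpace.{u} n, z.down ∈ contCell n N → z ∈ S)
    (hM : ∀ z : SymSpace.{u} n, z.down ∈ contCell n M → z ∈ S) :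
    Function.Bijective ((contStratification.{u} n).res F h) := by
  obtain ⟨ξ, hξ⟩ := exists_isPlaced_of_contMat M
  obtain ⟨ζ, hζ, hd⟩ := hξ.exists_degen h
  have hray : ∀ t : unitInterval, t ≠ 0 → (symPoint.{u} (ray ζ ξ t)).down ∈ contCell n M := by
    intro t ht
    have ht0 : (0 : ℝ) < t := lt_of_le_of_ne t.2.1 fun h => ht (Subtype.ext h.symm)
    rw [← contType_eq_iff, ← contType_symPoint_eq_iff.2 hξ]
    exact le_antisymm (hd.ray_degen t.2.1 t.2.2).contType_le (hd.degen_ray ht0 t.2.2).contType_le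
  refine PosetStratification.Conical.bijective_res (conical_of_constructible hF) hS h
    ⟨fun t => symPoint (ray ζ ξ t), continuous_symPoint.comp
      ((continuous_ray ζ).comp (by fun_prop : Continuous fun t : unitInterval => (ξ, (t : ℝ))))⟩
    (fun t => ?_) ?_ ?_ fun t => ?_
  · rcases eq_or_ne t 0 with rfl | ht
    · exact hN _ (symMk_mem_contCell_iff.2 (by simpa using hζ))
    · exact hM _ (hray t ht)
  · exact contType_symPoint_eq_iff.2 (by simpa using hζ)
  · exact contType_symPoint_eq_iff.2 (by simpa using hξ)
  · exact (le_contType_iff hζ).2 ⟨_, hd.ray t.2.1 t.2.2, rfl⟩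

end ContingencyStratification

/-! ### Complex strata and anodyne contractions. -/

section ComplexStrata

open Finset

variable {k : Type u} [Field k] {n : ℕ}

theorem ofSym_parts_of_eq_sum {T : Type*} [Fintype T] {z : Sym ℂ n} {g : T → ℕ} {P : T → ℂ}
    (hP : Function.Injective P) (hg : ∀ t, 0 < g t) (hz : pts z = ∑ t, g t • ({P t} : Multiset ℂ)) :
    (Nat.Partition.ofSym z).parts = univ.val.map g := by
  classical
  have hcount : ∀ t, (pts z).count (P t) = g t := by
    intro t
    rw [hz, Multiset.count_sum', sum_eq_single t]
    · simp
    · intro b _ hb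
      simp [hP.eq_iff, hb.symm]
    · simp
  have hdedup : (pts z).dedup = univ.val.map P := by
    refine (Multiset.Nodup.ext (Multiset.nodup_dedup _) (univ.nodup.map hP)).2 fun w => ?_
    rw [Multiset.mem_dedup, hz, Multiset.mem_sum]
    simp only [mem_univ, true_and, Multiset.mem_map, mem_val]
    refine exists_congr fun t => ?_
    rw [Multiset.mem_nsmul, Multiset.mem_singleton]
    exact ⟨fun h => h.2.symm, fun h => ⟨(hg t).ne', h.symm⟩⟩
  change (pts z).dedup.map (pts z).count = _
  rw [hdedup, Multiset.map_map]
  exact Multiset.map_congr rfl fun t _ => hcount t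

/-- The multiplicities are the sizes of the classes of coinciding indices, so both partitions are
computed over the quotient by this common relation. -/
theorem ofSym_eq_of_kernel_eq {ζ ξ : Fin n → ℂ} (h : ∀ ν μ, ζ ν = ζ μ ↔ ξ ν = ξ μ) :
    Nat.Partition.ofSym (symMk ζ) = Nat.Partition.ofSym (symMk ξ) := by
  classical
  have key : ∀ χ : Fin n → ℂ, (∀ ν μ, ζ ν = ζ μ ↔ χ ν = χ μ) →
      (Nat.Partition.ofSym (symMk χ)).parts =
        (univ : Finset (Quotient (Setoid.ker ζ))).val.map
          fun t => #{ν | (Quotient.mk _ ν : Quotient (Setoid.ker ζ)) = t} := by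
    intro χ hχ
    refine ofSym_parts_of_eq_sum (P := Quotient.lift χ fun ν μ hνμ => (hχ ν μ).1 hνμ) ?_ ?_ ?_
    · rintro ⟨ν⟩ ⟨μ⟩ hνμ
      exact Quotient.sound ((hχ ν μ).2 hνμ)
    · intro t
      obtain ⟨ν, rfl⟩ := Quotient.exists_rep t
      exact card_pos.2 ⟨ν, by simp⟩
    · have h1 : pts (symMk χ) = ∑ ν, ({χ ν} : Multiset ℂ) := by
        refine (Multiset.sum_map_singleton _).symm.trans (congrArg Multiset.sum ?_)
        exact Multiset.map_map (fun a => ({a} : Multiset ℂ)) χ univ.val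
      rw [h1, ← sum_fiberwise univ (fun ν => (Quotient.mk _ ν : Quotient (Setoid.ker ζ)))]
      refine sum_congr rfl fun t _ => ?_
      rw [← sum_const]
      refine sum_congr rfl fun ν hν => ?_
      rw [← (mem_filter.1 hν).2]
      rfl
  exact Nat.Partition.ext ((key ζ fun _ _ => Iff.rfl).trans (key ξ h).symm)

theorem card_image_eq_of_ofSym_eq {ζ ξ : Fin n → ℂ}
    (h : Nat.Partition.ofSym (symMk ζ) = Nat.Partition.ofSym (symMk ξ)) :
    #(univ.image ζ) = #(univ.image ξ) := by
  have key : ∀ χ : Fin n → ℂ, (Nat.Partition.ofSym (symMk χ)).parts.card = #(univ.image χ) := by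
    intro χ
    change Multiset.card (Multiset.map _ (pts (symMk χ)).dedup) = _
    rw [Multiset.card_map]
    rfl
  rw [← key, ← key, h]

theorem Degen.eq_of_eq {ζ ξ : Fin n → ℂ} (h : Degen ζ ξ) {ν μ : Fin n} (e : ξ ν = ξ μ) :
    ζ ν = ζ μ :=
  Complex.ext (h.re_eq (congrArg _ e)) (h.im_eq (congrArg _ e))

/-- Coinciding points of `ξ` coincide in `ζ`, so the points of `ξ` map onto those of `ζ`. Equal
partitions have equally many parts, and a surjection between finite sets of the same size is
injective: no collision occurs. -/
theorem Degen.eq_iff_of_ofSym_eq {ζ ξ : Fin n → ℂ} (h : Degen ζ ξ)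
    (e : Nat.Partition.ofSym (symMk ζ) = Nat.Partition.ofSym (symMk ξ)) (ν μ : Fin n) :
    ζ ν = ζ μ ↔ ξ ν = ξ μ := by
  refine ⟨fun hζ => ?_, h.eq_of_eq⟩
  have hf : Function.FactorsThrough ζ ξ := fun _ _ => h.eq_of_eq
  have hG : ∀ ν, Function.extend ξ ζ 0 (ξ ν) = ζ ν := hf.extend_apply 0
  have himg : (univ.image ξ).image (Function.extend ξ ζ 0) = univ.image ζ := by
    rw [image_image]
    exact image_congr fun ν _ => hG ν
  have hinj : Set.InjOn (Function.extend ξ ζ 0) (univ.image ξ) := by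
    refine card_image_iff.1 ?_
    rw [himg]
    exact card_image_eq_of_ofSym_eq e
  refine hinj (by simp) (by simp) ?_
  rw [hG, hG, hζ]

theorem ofSym_symMk_swap (ζ : Fin n → ℂ) :
    Nat.Partition.ofSym (symMk fun ν => swapReIm (ζ ν)) = Nat.Partition.ofSym (symMk ζ) :=
  ofSym_eq_of_kernel_eq fun ν μ =>
    ⟨fun h => Complex.ext (congrArg Complex.im h) (congrArg Complex.re h), fun h => by rw [h]⟩

theorem IsPlaced.contCell_subset {M : ContMat n} {ξ : Fin n → ℂ} (h : IsPlaced M ξ) :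
    contCell n M ⊆ complexStratum n (Nat.Partition.ofSym (symMk ξ)) := by
  intro z hz
  obtain ⟨ζ, rfl⟩ := symMk_surjective z
  obtain ⟨π, h1, h2⟩ := h.exists_perm (symMk_mem_contCell_iff.1 hz)
  have h3 : symMk (fun ν => ζ (π ν)) = symMk ζ := symMk_eq_iff.2 ⟨π, fun _ => rfl⟩
  change Nat.Partition.ofSym (symMk ζ) = _
  rw [← h3]
  exact ofSym_eq_of_kernel_eq fun ν μ => ⟨h1.eq_of_eq, h2.eq_of_eq⟩

theorem sameComplexStratum_iff {N M : ContMat n} {ζ ξ : Fin n → ℂ} (hζ : IsPlaced N ζ)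
    (hξ : IsPlaced M ξ) :
    SameComplexStratum N M ↔ Nat.Partition.ofSym (symMk ζ) = Nat.Partition.ofSym (symMk ξ) := by
  constructor
  · rintro ⟨l, hN, hM⟩
    exact (hN (symMk_mem_contCell_iff.2 hζ)).trans (hM (symMk_mem_contCell_iff.2 hξ)).symm
  · intro h
    exact ⟨_, hζ.contCell_subset, h ▸ hξ.contCell_subset⟩

/-- Coincidences only increase under degeneration, so those of an intermediate configuration are
squeezed between two equal relations. -/
theorem SameComplexStratum.of_le_of_le {N L M : ContMat n} (h : SameComplexStratum N M)
    (hNL : N ≤ L) (hLM : L ≤ M) : SameComplexStratum N L ∧ SameComplexStratum L M := by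
  obtain ⟨ξ, hξ⟩ := exists_isPlaced_of_contMat M
  obtain ⟨χ, hχ, h1⟩ := hξ.exists_degen hLM
  obtain ⟨ζ, hζ, h2⟩ := hχ.exists_degen hNL
  have h3 := (h2.trans h1).eq_iff_of_ofSym_eq ((sameComplexStratum_iff hζ hξ).1 h)
  rw [sameComplexStratum_iff hζ hχ, sameComplexStratum_iff hχ hξ]
  exact ⟨ofSym_eq_of_kernel_eq fun ν μ => ⟨fun e => h1.eq_of_eq ((h3 ν μ).1 e), h2.eq_of_eq⟩,
    ofSym_eq_of_kernel_eq fun ν μ => ⟨fun e => (h3 ν μ).1 (h2.eq_of_eq e), h1.eq_of_eq⟩⟩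

theorem SameComplexStratum.transpose {N M : ContMat n} (h : SameComplexStratum N M) :
    SameComplexStratum N.transpose M.transpose := by
  obtain ⟨ζ, hζ⟩ := exists_isPlaced_of_contMat N
  obtain ⟨ξ, hξ⟩ := exists_isPlaced_of_contMat M
  rw [sameComplexStratum_iff hζ.swap hξ.swap, ofSym_symMk_swap, ofSym_symMk_swap]
  exact (sameComplexStratum_iff hζ hξ).1 h

theorem anodyneInvertible.isIso {R : ContRep.{u} k n} (hR : anodyneInvertible k n R)
    {N M : ContMat n} (h : N ≤ M) (hs : SameComplexStratum N M) : IsIso (R.map (homOfLE h)) := by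
  have h' : Relation.ReflTransGen ContMat.IsContraction M N := h
  induction h' with
  | refl => exact inferInstanceAs (IsIso (R.map (𝟙 M)))
  | @tail L N hML hLN ih =>
    have hNL : N ≤ L := Relation.ReflTransGen.single hLN
    obtain ⟨h1, h2⟩ := hs.of_le_of_le hNL hML
    have := ih hML h2
    have : IsIso (R.map (homOfLE hNL)) := by
      rcases hLN with ⟨i, rfl⟩ | ⟨j, rfl⟩
      · exact hR.1 L i h1
      · exact hR.2 L j h1
    have e : homOfLE h = homOfLE hNL ≫ homOfLE hML := rfl
    rw [e, R.map_comp]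
    infer_instance

theorem constructible_complexStratum_le :
    constructible.{u} k (complexStratum n) ≤ constructible.{u} k (contCell n) := by
  intro F hF
  rw [constructible_iff] at hF ⊢
  intro M
  obtain ⟨ζ, hζ⟩ := exists_isPlaced_of_contMat M
  exact (hF _).mono (Set.preimage_mono hζ.contCell_subset)

theorem SameComplexStratum.bijective_res {F : (SymSpace.{u} n).Sheaf (ModuleCat.{u} k)}
    (hF : constructible k (complexStratum n) F) {N M : ContMat n} (h : N ≤ M)
    (hs : SameComplexStratum N M) : Function.Bijective ((contStratification.{u} n).res F h) := by
  obtain ⟨l, hN, hM⟩ := hs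
  exact bijective_res_of_locConstOn (constructible_complexStratum_le F hF)
    (constructible_iff.1 hF l) h (fun z hz => hN hz) fun z hz => hM hz

/-- Anodyne contractions generate all relations `N ≤ M` inside a complex stratum, so invertibility
along them is the hypothesis of `Conical.locConstOn`. The converse transports sections along rays
within the stratum. -/
theorem constructible_complexStratum_iff (F : ConstrSh.{u} k (contCell n)) :
    constructible.{u} k (complexStratum n) F.obj ↔
      anodyneInvertible.{u} k n ((stalkFunctorCont k n).obj F) := by
  constructor
  · intro hF
    exact ⟨fun M i hi => (ConcreteCategory.isIso_iff_bijective _).2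
        (SameComplexStratum.bijective_res hF (M.contrH_le i) hi),
      fun M j hj => (ConcreteCategory.isIso_iff_bijective _).2
        (SameComplexStratum.bijective_res hF (M.contrV_le j) hj)⟩
  · intro hR
    refine constructible_iff.2 fun l => (conical_of_constructible F.property).locConstOn
      fun x hx y hy h => ?_
    obtain ⟨ζ, rfl⟩ := symPoint_surjective x
    obtain ⟨ξ, rfl⟩ := symPoint_surjective y
    exact (ConcreteCategory.isIso_iff_bijective _).1 (hR.isIso h
      ((sameComplexStratum_iff (isPlaced_contType ζ) (isPlaced_contType ξ)).2
        (Eq.trans hx (Eq.symm hy))))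

end ComplexStrata

/-! ### Fox–Neuwirth–Fuchs cells. -/

section FoxNeuwirthFuchs

open Finset

variable {k : Type u} [Field k] {n : ℕ}

theorem exists_mem_realCell {d : ℕ} {s : Multiset ℝ} (hs : s.card = d) :
    ∃ β : Composition d, s ∈ realCell β := by
  classical
  let y := s.toFinset.orderIsoOfFin rfl
  have hsum : s = ∑ j, s.count (y j : ℝ) • ({(y j : ℝ)} : Multiset ℝ) := by
    conv_lhs => rw [← s.toFinset_sum_count_nsmul_eq, ← sum_coe_sort s.toFinset]
    exact (Equiv.sum_comp y.toEquiv fun t : s.toFinset =>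
      s.count (t : ℝ) • ({(t : ℝ)} : Multiset ℝ)).symm
  let β : Composition d := ⟨List.ofFn fun j => s.count (y j : ℝ), by
      intro i hi
      obtain ⟨j, rfl⟩ := (List.mem_ofFn' _ _).1 hi
      exact Multiset.count_pos.2 (Multiset.mem_toFinset.1 (y j).2), by
      rw [List.sum_ofFn, ← hs]
      conv_rhs => rw [hsum]
      simp⟩
  have hl : β.length = #s.toFinset := List.length_ofFn
  refine ⟨β, fun j => y (Fin.cast hl j), fun i j hij => y.strictMono hij, hsum.trans ?_⟩
  rw [← Equiv.sum_comp (finCongr hl)]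
  refine sum_congr rfl fun j _ => ?_
  have hb : β.blocksFun j = s.count (y (Fin.cast hl j) : ℝ) := by
    simp only [Composition.blocksFun, β, List.get_ofFn]
  rw [hb]
  rfl

theorem map_composition_sum {d : ℕ} {β : Composition d} {E E' : Type*} {s : Multiset E}
    {y : Fin β.length → E} (hs : s = ∑ j, β.blocksFun j • ({y j} : Multiset E)) (f : E → E') :
    s.map f = ∑ j, β.blocksFun j • ({f (y j)} : Multiset E') := by
  rw [hs]
  change Multiset.mapAddMonoidHom f _ = _
  rw [map_sum]
  exact sum_congr rfl fun j _ => by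
    rw [map_nsmul]
    rfl

theorem mem_of_composition_sum {d : ℕ} {β : Composition d} {E : Type*} {s : Multiset E}
    {y : Fin β.length → E} (hs : s = ∑ j, β.blocksFun j • ({y j} : Multiset E)) (j) : y j ∈ s := by
  rw [hs, Multiset.mem_sum]
  exact ⟨j, mem_univ _, Multiset.mem_nsmul.2
    ⟨Nat.one_le_iff_ne_zero.1 (β.one_le_blocksFun j), by simp⟩⟩

/-- If `u` and `v` order the indices in `A` alike, then `v` is a function of `u` that is increasing
on its values; it moves the support points and keeps the multiplicities. -/
theorem exists_map_realCell {d : ℕ} {β : Composition d} {A : Finset (Fin n)} {u v : Fin n → ℝ}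
    (h : ∀ ν ∈ A, ∀ μ ∈ A, (u ν < u μ ↔ v ν < v μ)) {y : Fin β.length → ℝ} (hy : StrictMono y)
    (hs : A.val.map u = ∑ j, β.blocksFun j • ({y j} : Multiset ℝ)) :
    ∃ f : ℝ → ℝ, (∀ ν ∈ A, f (u ν) = v ν) ∧ StrictMono (fun j => f (y j)) ∧
      A.val.map v = ∑ j, β.blocksFun j • ({f (y j)} : Multiset ℝ) := by
  have hfac : Function.FactorsThrough (fun ν : A => v ν) (fun ν : A => u ν) := by
    intro ν μ e
    have h1 := h ν ν.2 μ μ.2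
    have h2 := h μ μ.2 ν ν.2
    simp only at e
    rw [e] at h1 h2
    exact le_antisymm (not_lt.1 fun hl => lt_irrefl _ (h2.2 hl))
      (not_lt.1 fun hl => lt_irrefl _ (h1.2 hl))
  let f := Function.extend (fun ν : A => u ν) (fun ν : A => v ν) 0
  have hf : ∀ ν ∈ A, f (u ν) = v ν := fun ν hν => hfac.extend_apply 0 ⟨ν, hν⟩
  refine ⟨f, hf, fun i j hij => ?_, ?_⟩
  · obtain ⟨ν, hν, hνi⟩ := Multiset.mem_map.1 (mem_of_composition_sum hs i)
    obtain ⟨μ, hμ, hμj⟩ := Multiset.mem_map.1 (mem_of_composition_sum hs j)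
    change f (y i) < f (y j)
    rw [← hνi, ← hμj, hf _ hν, hf _ hμ, ← h _ hν _ hμ, hνi, hμj]
    exact hy hij
  · rw [← map_composition_sum hs f, Multiset.map_map]
    exact Multiset.map_congr rfl fun ν hν => (hf ν hν).symm

/-- Two ordered configurations have the same horizontal lines and the same order of points on each
of them. -/
def LineEquiv (ζ ξ : Fin n → ℂ) : Prop :=
  ∀ ν μ, ((ζ ν).im < (ζ μ).im ↔ (ξ ν).im < (ξ μ).im) ∧
    ((ζ ν).im = (ζ μ).im → ((ζ ν).re < (ζ μ).re ↔ (ξ ν).re < (ξ μ).re))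

theorem LineEquiv.im_eq_iff {ζ ξ : Fin n → ℂ} (h : LineEquiv ζ ξ) (ν μ : Fin n) :
    (ξ ν).im = (ξ μ).im ↔ (ζ ν).im = (ζ μ).im := by
  rw [le_antisymm_iff, le_antisymm_iff (a := (ζ ν).im), ← not_lt, ← not_lt, ← not_lt, ← not_lt,
    (h ν μ).1, (h μ ν).1]

theorem map_re_filter_pts (ζ : Fin n → ℂ) (t : ℝ) :
    ((pts (symMk ζ)).filter (fun w => w.im = t)).map Complex.re =
      ({ν | (ζ ν).im = t} : Finset (Fin n)).val.map fun ν => (ζ ν).re := by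
  change ((univ.val.map ζ).filter _).map _ = _
  rw [Multiset.filter_map, Multiset.map_map]
  rfl

/-- The transfer of real cells is applied once to the imaginary parts and once to the real parts on
each line, after checking in `hA` that the line carries the same indices in both configurations. -/
theorem LineEquiv.mem_fnfCell {ζ ξ : Fin n → ℂ} (h : LineEquiv ζ ξ) {a : FNFIndex n}
    (hζ : symMk ζ ∈ fnfCell n a) : symMk ξ ∈ fnfCell n a := by
  obtain ⟨y, hy, hs, hγ⟩ := hζ
  have hs' : univ.val.map (fun ν => (ζ ν).im) =
      ∑ j, a.1.blocksFun j • ({y j} : Multiset ℝ) := by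
    rw [← hs]
    exact (Multiset.map_map _ _ _).symm
  obtain ⟨f, hf, hfy, hfs⟩ := exists_map_realCell (v := fun ν => (ξ ν).im)
    (fun ν _ μ _ => (h ν μ).1) hy hs'
  refine ⟨fun j => f (y j), hfy, (Multiset.map_map _ _ _).trans hfs, fun j => ?_⟩
  obtain ⟨x, hx, hxs⟩ := hγ j
  have hA : ({ν | (ξ ν).im = f (y j)} : Finset (Fin n)) =
      ({ν | (ζ ν).im = y j} : Finset (Fin n)) := by
    obtain ⟨μ, -, hμ⟩ := Multiset.mem_map.1 (mem_of_composition_sum hs' j)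
    ext ν
    simp only [mem_filter, mem_univ, true_and]
    rw [← hμ, hf μ (mem_univ _), h.im_eq_iff]
  rw [map_re_filter_pts] at hxs ⊢
  rw [hA]
  obtain ⟨g, -, hgx, hgs⟩ := exists_map_realCell (v := fun ν => (ξ ν).re)
    (fun ν hν μ hμ => (h ν μ).2 ((mem_filter.1 hν).2.trans (mem_filter.1 hμ).2.symm)) hx hxs
  exact ⟨_, hgx, hgs⟩

theorem count_composition_sum {d : ℕ} {β : Composition d} {s : Multiset ℝ}
    {y : Fin β.length → ℝ} (hy : StrictMono y)
    (hs : s = ∑ j, β.blocksFun j • ({y j} : Multiset ℝ)) (j) : s.count (y j) = β.blocksFun j := by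
  rw [hs, Multiset.count_sum', sum_eq_single j]
  · simp
  · intro b _ hb
    simp [hy.injective.eq_iff, hb.symm]
  · simp

theorem exists_mem_fnfCell (z : Sym ℂ n) : ∃ a, z ∈ fnfCell n a := by
  obtain ⟨β, y, hy, hs⟩ := exists_mem_realCell (s := (pts z).map Complex.im) (d := n) (by
    rw [Multiset.card_map]; exact z.2)
  have h : ∀ j, ∃ γ : Composition (β.blocksFun j),
      ((pts z).filter (fun w => w.im = y j)).map Complex.re ∈ realCell γ := fun j => by
    refine exists_mem_realCell ?_
    rw [Multiset.card_map, ← count_composition_sum hy hs j, Multiset.count_map]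
    simp only [eq_comm]
  choose γ hγ using h
  exact ⟨⟨β, γ⟩, y, hy, hs, hγ⟩

/-- The parts of all the compositions of the lines are the multiplicities of the distinct points, so
the label of the cell determines the complex stratum. -/
theorem ofSym_parts_of_mem_fnfCell {z : Sym ℂ n} {a : FNFIndex n} (hz : z ∈ fnfCell n a) :
    (Nat.Partition.ofSym z).parts = (univ : Finset (Σ j, Fin (a.2 j).length)).val.map
      fun t => (a.2 t.1).blocksFun t.2 := by
  classical
  obtain ⟨y, hy, hs, hγ⟩ := hz
  choose x hx hxs using hγ
  refine ofSym_parts_of_eq_sum (P := fun t => ⟨x t.1 t.2, y t.1⟩) ?_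
    (fun t => (a.2 t.1).one_le_blocksFun t.2) ?_
  · rintro ⟨j, i⟩ ⟨j', i'⟩ h
    obtain rfl : j = j' := hy.injective (congrArg Complex.im h)
    obtain rfl : i = i' := (hx j).injective (congrArg Complex.re h)
    rfl
  · rw [Fintype.sum_sigma]
    have h1 : ∀ j, (pts z).filter (fun w => w.im = y j) =
        ∑ i, (a.2 j).blocksFun i • ({⟨x j i, y j⟩} : Multiset ℂ) := fun j => by
      rw [← map_composition_sum (hxs j) fun t => (⟨t, y j⟩ : ℂ), Multiset.map_map]
      conv_lhs => rw [← Multiset.map_id (Multiset.filter _ _)]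
      refine Multiset.map_congr rfl fun w hw => ?_
      exact Complex.ext rfl (Multiset.mem_filter.1 hw).2
    simp only [← h1]
    ext w
    rw [Multiset.count_sum']
    simp only [Multiset.count_filter]
    by_cases hw : w ∈ pts z
    · have h2 : w.im ∈ (pts z).map Complex.im := Multiset.mem_map_of_mem _ hw
      rw [hs, Multiset.mem_sum] at h2
      obtain ⟨j, -, hj⟩ := h2
      have hj' : w.im = y j := Multiset.mem_singleton.1 (Multiset.mem_nsmul.1 hj).2
      rw [sum_eq_single j]
      · rw [if_pos hj']
      · intro b _ hb
        rw [if_neg]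
        rw [hj', hy.injective.eq_iff]
        exact hb.symm
      · simp
    · simp [Multiset.count_eq_zero_of_notMem hw]

theorem symMk_mem_ifnfCell_iff {ζ : Fin n → ℂ} {a : FNFIndex n} :
    symMk ζ ∈ ifnfCell n a ↔ symMk (fun ν => swapReIm (ζ ν)) ∈ fnfCell n a := by
  have hmap : ∀ ξ : Fin n → ℂ, Sym.map swapReIm (symMk ξ) = symMk fun ν => swapReIm (ξ ν) :=
    fun ξ => by
      apply Subtype.ext
      change (univ.val.map ξ).map swapReIm = _
      rw [Multiset.map_map]
      rfl
  constructor
  · rintro ⟨z, hz, h⟩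
    obtain ⟨ξ, rfl⟩ := symMk_surjective z
    have h1 := congrArg (Sym.map swapReIm) h
    rw [hmap, hmap, hmap] at h1
    rwa [← h1]
  · intro h
    exact ⟨_, h, hmap _⟩

theorem exists_fnfCell_subset (a : FNFIndex n) : ∃ l, fnfCell n a ⊆ complexStratum n l := by
  rcases (fnfCell n a).eq_empty_or_nonempty with h | ⟨z, hz⟩
  -- Any partition serves for an empty cell, so nonemptiness of the cells need not be proved.
  · exact ⟨default, by simp [h]⟩
  · exact ⟨Nat.Partition.ofSym z, fun w hw => Nat.Partition.ext
      ((ofSym_parts_of_mem_fnfCell hw).trans (ofSym_parts_of_mem_fnfCell hz).symm)⟩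

theorem exists_ifnfCell_subset (a : FNFIndex n) : ∃ l, ifnfCell n a ⊆ complexStratum n l := by
  obtain ⟨l, hl⟩ := exists_fnfCell_subset a
  refine ⟨l, fun z hz => ?_⟩
  obtain ⟨ζ, rfl⟩ := symMk_surjective z
  exact (ofSym_symMk_swap ζ).symm.trans (hl (symMk_mem_ifnfCell_iff.1 hz))

theorem IsPlaced.contCell_subset_fnfCell {M : ContMat n} {ξ : Fin n → ℂ} (h : IsPlaced M ξ)
    {a : FNFIndex n} (ha : symMk ξ ∈ fnfCell n a) : contCell n M ⊆ fnfCell n a := by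
  intro z hz
  obtain ⟨ζ, rfl⟩ := symMk_surjective z
  obtain ⟨π, h1, h2⟩ := h.exists_perm (symMk_mem_contCell_iff.1 hz)
  have h3 : symMk (fun ν => ζ (π ν)) = symMk ζ := symMk_eq_iff.2 ⟨π, fun _ => rfl⟩
  rw [← h3]
  exact LineEquiv.mem_fnfCell (fun ν μ =>
    ⟨⟨(h1 ν μ).2, (h2 ν μ).2⟩, fun _ => ⟨(h1 ν μ).1, (h2 ν μ).1⟩⟩) ha

/-- A horizontal contraction keeps all imaginary parts and can change the order on a line only by a
collision, which anodyneness forbids. -/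
theorem AnodyneH.exists_fnfCell {M : ContMat n} {i : Fin (M.p - 1)} (h : AnodyneH M i) :
    ∃ a, contCell n (M.contrH i) ⊆ fnfCell n a ∧ contCell n M ⊆ fnfCell n a := by
  obtain ⟨ξ, hξ⟩ := exists_isPlaced_of_contMat M
  obtain ⟨ζ, hζ, hd, him⟩ := hξ.exists_contrH i
  obtain ⟨a, ha⟩ := exists_mem_fnfCell (symMk ζ)
  have heq := hd.eq_iff_of_ofSym_eq ((sameComplexStratum_iff hζ hξ).1 h)
  refine ⟨a, hζ.contCell_subset_fnfCell ha, hξ.contCell_subset_fnfCell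
    (LineEquiv.mem_fnfCell (fun ν μ => ⟨by rw [him, him], fun e => ⟨(hd ν μ).1, fun hl => ?_⟩⟩) ha)⟩
  rcases lt_trichotomy (ζ ν).re (ζ μ).re with h1 | h1 | h1
  · exact h1
  · exact absurd (congrArg Complex.re ((heq ν μ).1 (Complex.ext h1 e))) hl.ne
  · exact absurd ((hd μ ν).1 h1) hl.asymm

theorem contCell_transpose_subset_ifnfCell {N : ContMat n} {a : FNFIndex n}
    (h : contCell n N.transpose ⊆ fnfCell n a) : contCell n N ⊆ ifnfCell n a := by
  intro z hz
  obtain ⟨ζ, rfl⟩ := symMk_surjective z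
  exact symMk_mem_ifnfCell_iff.2
    (h (symMk_mem_contCell_iff.2 (symMk_mem_contCell_iff.1 hz).swap))

theorem AnodyneV.exists_ifnfCell {M : ContMat n} {j : Fin (M.q - 1)} (h : AnodyneV M j) :
    ∃ a, contCell n (M.contrV j) ⊆ ifnfCell n a ∧ contCell n M ⊆ ifnfCell n a := by
  obtain ⟨a, h1, h2⟩ := AnodyneH.exists_fnfCell (M := M.transpose) (i := j)
    (SameComplexStratum.transpose h)
  exact ⟨a, contCell_transpose_subset_ifnfCell h1, contCell_transpose_subset_ifnfCell h2⟩

/-- One direction is inclusion of both kinds of cells in complex strata. For the other, anodyne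
horizontal contractions are tested inside Fox–Neuwirth–Fuchs cells and vertical ones inside the dual
cells. -/
theorem constructible_complexStratum_iff_fnfCell {F : (SymSpace.{u} n).Sheaf (ModuleCat.{u} k)}
    (hF : constructible.{u} k (contCell n) F) :
    constructible.{u} k (complexStratum n) F ↔
      constructible.{u} k (fnfCell n) F ∧ constructible.{u} k (ifnfCell n) F := by
  constructor
  · intro h
    rw [constructible_iff] at h
    refine ⟨constructible_iff.2 fun a => ?_, constructible_iff.2 fun a => ?_⟩
    · obtain ⟨l, hl⟩ := exists_fnfCell_subset a
      exact (h l).mono (Set.preimage_mono hl)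
    · obtain ⟨l, hl⟩ := exists_ifnfCell_subset a
      exact (h l).mono (Set.preimage_mono hl)
  · rintro ⟨h1, h2⟩
    refine (constructible_complexStratum_iff ⟨F, hF⟩).2 ⟨fun M i hi => ?_, fun M j hj => ?_⟩
    · obtain ⟨a, hN, hM⟩ := hi.exists_fnfCell
      exact (ConcreteCategory.isIso_iff_bijective _).2 (bijective_res_of_locConstOn hF
        (constructible_iff.1 h1 a) (M.contrH_le i) (fun z hz => hN hz) fun z hz => hM hz)
    · obtain ⟨a, hN, hM⟩ := hj.exists_ifnfCell
      exact (ConcreteCategory.isIso_iff_bijective _).2 (bijective_res_of_locConstOn hF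
        (constructible_iff.1 h2 a) (M.contrV_le j) (fun z hz => hN hz) fun z hz => hM hz)

end FoxNeuwirthFuchs

/-! ### Restriction to full subcategories and conclusion. -/

section Restriction

/-- A fully faithful functor between full subcategories of categories related by an equivalence
which identifies the two subcategories is an equivalence. -/
theorem isEquivalence_objectProperty_lift {C D : Type*} [Category C] [Category D]
    {P Q : ObjectProperty C} (h : P ≤ Q) (E : Q.FullSubcategory ≌ D) (R : ObjectProperty D)
    [R.IsClosedUnderIsomorphisms] (hR : ∀ F : Q.FullSubcategory, P F.obj ↔ R (E.functor.obj F)) :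
    (R.lift (ObjectProperty.ιOfLE h ⋙ E.functor)
      fun F => (hR ⟨F.obj, h _ F.property⟩).1 F.property).IsEquivalence where
  faithful := inferInstance
  full := inferInstance
  -- A preimage under the ambient equivalence satisfies `P`, since `R` is closed under isomorphisms
  -- and the counit is one.
  essSurj := ⟨fun G => by
    have e := E.counitIso.app G.obj
    have hG := (hR (E.inverse.obj G.obj)).2 (R.prop_of_iso e.symm G.property)
    exact ⟨⟨(E.inverse.obj G.obj).obj, hG⟩, ⟨R.isoMk e⟩⟩⟩

end Restriction

instance (k : Type u) [Field k] (n : ℕ) :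
    (anodyneInvertible.{u} k n).IsClosedUnderIsomorphisms where
  of_iso {R R'} e h := by
    have key : ∀ {N M : ContMat n} (f : N ⟶ M), IsIso (R.map f) → IsIso (R'.map f) := fun f hf =>
      (NatIso.isIso_map_iff e f).1 hf
    exact ⟨fun M i hi => key _ (h.1 M i hi), fun M j hj => key _ (h.2 M j hj)⟩

theorem corollary5p5 (k : Type u) [Field k] (n : ℕ) :
    ∃ E : ConstrSh.{u} k (contCell n) ≌ ContRep.{u} k n,
      IsStalkRep E.functor ∧
      (∃ (hle : constructible.{u} k (complexStratum n) ≤ constructible.{u} k (contCell n))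
        (E' : ConstrSh.{u} k (complexStratum n) ≌ (anodyneInvertible.{u} k n).FullSubcategory),
        Nonempty (E'.functor ⋙ (anodyneInvertible.{u} k n).ι ≅
          ObjectProperty.ιOfLE hle ⋙ E.functor)) ∧
      (∀ F : ConstrSh.{u} k (contCell n),
        constructible.{u} k (complexStratum n) F.obj ↔
          anodyneInvertible.{u} k n (E.functor.obj F)) ∧
      (∀ F : (SymSpace.{u} n).Sheaf (ModuleCat.{u} k),
        constructible.{u} k (contCell n) F →
          (constructible.{u} k (complexStratum n) F ↔
            constructible.{u} k (fnfCell n) F ∧ constructible.{u} k (ifnfCell n) F)) := by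
  have h := isEquivalence_objectProperty_lift constructible_complexStratum_le
    (stalkFunctorCont k n).asEquivalence (anodyneInvertible k n) constructible_complexStratum_iff
  exact ⟨(stalkFunctorCont k n).asEquivalence, isStalkRep_stalkFunctorCont,
    ⟨constructible_complexStratum_le, @Functor.asEquivalence _ _ _ _ _ h, ⟨Iso.refl _⟩⟩,
    constructible_complexStratum_iff, fun _ => constructible_complexStratum_iff_fnfCell⟩
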